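/- **Setting.** There are $d$ arms and an arbitrary set $\mathcal A\subset\{0,1\}^d$ of actions, each with exactly $m$ non-zero entries, $1\le m\le d$. At each stage $t\ge1$ a learner chooses $A_t\in\mathcal A$, using only the past and possibly internal randomization, and then the reward vector $X_t\in\mathbb R^d$ is drawn; the learner observes the coordinates $X_t^{(i)}$ with $i\in A_t$ and earns $A_t^\top X_t$. The vectors $X_1,X_2,\dots$ are i.i.d. with mean $\mu$, $X_t$ is independent of the past and of $A_t$, and there is a positive semi-definite matrix $C$ with $\mathbb E[e^{u^\top(X_t-\mu)}]\le e^{\frac12u^\top Cu}$ for all $u\in\mathbb R^d$. Let $\Gamma$ be a known positive semi-definite matrix with non-negative coefficients and at least one positive diagonal coefficient, such that $v^\top Cv\le v^\top\Gamma v$ for all vectors $v$ with non-negative coordinates. Let $A^*\in\mathcal A$ maximize $A^\top\mu$ over $\mathcal A$, let $\Delta_A=A^{*\top}\mu-A^\top\mu$, and let $\mathbb E R_T=\mathbb E\sum_{t=1}^T\Delta_{A_t}$. **Algorithm.** For a matrix $M$ let $\Sigma_M$ be the diagonal matrix with the diagonal of $M$; for an action $A$ let $I_A=\mathrm{diag}(A)$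 and $M_A=I_AMI_A$. Let $D_t=\sum_{s<t}I_{A_s}$, let $\hat\mu_t^{(i)}$ be the average of the $X_s^{(i)}$ over the stages $s<t$ with $i\in A_s$, and for $\lambda>0$ let $$f(t)=\log t+(m+2)\log\log t+\tfrac m2\log\!\big(1+\tfrac e\lambda\big),$$ $$E_t(A)=\sqrt{2f(t)}\,\sqrt{A^\top D_t^{-1}\Big(\lambda\Sigma_\Gamma D_t+\sum_{s<t}\Gamma_{A_s}\Big)D_t^{-1}A}.$$ OLS-UCB with matrix $\Gamma$ and parameter $\lambda$ chooses actions in an initialization of $N$ stages such that each arm is pulled at least once, and at each stage $t>N$ plays some $A_t\in\arg\max_{A\in\mathcal A}\big(A^\top\hat\mu_t+E_t(A)\big)$. Let $\gamma_t=\max_{i\ne j\in A_t}\Gamma^{(ij)}/\sqrt{\Gamma^{(ii)}\Gamma^{(jj)}}$ (with $0/0=0$, and $\gamma_t=0$ if $m=1$), and $\gamma=\max_{t\le T}\gamma_t\in[0,1]$, a function of the actions $A_1,\dots,A_T$. Let $\lceil x\rceil$ be the smallest positive integer that is at least $x$ (so $\lceil0\rceil=1$). **Statement.** There is a universal constant $c>0$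 such that for all $d\ge m\ge1$, $\Gamma$, $\lambda>0$, $N$ and $B$ there is $T_0$, depending only on $(d,m,\Gamma,\lambda,N,B)$, with the following property. For every such problem ($\mathcal A$, $\mu$, $C$, law of the rewards) all of whose gaps are at most $B$, every run of OLS-UCB with matrix $\Gamma$, parameter $\lambda$ and an initialization of $N$ stages satisfies, for all $T\ge T_0$, $$\mathbb E R_T\;\le\; c\;\mathbb E\left[\sqrt{d\,T\log T\;\max_{i\in[d]}\Gamma^{(ii)}\left(5(\lambda+1-\gamma)\left\lceil\tfrac{\log m}{1.6}\right\rceil^2+45\,\gamma\,m\right)}\right].$$ In particular neither $c$ nor $T_0$ depends on the positive gaps being bounded away from $0$. -/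

import Mathlib

open MeasureTheory ProbabilityTheory

/-! Stochastic combinatorial semi-bandits and the OLS-UCB algorithm.

Arms are the elements of `Fin d`. An action, a vector of `{0,1}^d`, is given by the set
`S : Finset (Fin d)` of its non-zero coordinates. Stages are `t = 1, 2, …`; the values of the
processes at index `0` play no role. -/

noncomputable section

namespace SemiBandit

variable {d : ℕ}

/-- The vector of `{0,1}^d` of an action. -/
def actionVec (S : Finset (Fin d)) : Fin d → ℝ := fun i => if i ∈ S then 1 else 0

/-- The diagonal matrix `I_S`. -/
def actionMat (S : Finset (Fin d)) : Matrix (Fin d) (Fin d) ℝ := Matrix.diagonal (actionVec S)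

/-- `M_S = I_S M I_S`. -/
def restrict (M : Matrix (Fin d) (Fin d) ℝ) (S : Finset (Fin d)) : Matrix (Fin d) (Fin d) ℝ :=
  actionMat S * M * actionMat S

/-- The mean reward `Sᵀ μ` of an action. -/
def reward (v : Fin d → ℝ) (S : Finset (Fin d)) : ℝ := actionVec S ⬝ᵥ v

/-- `C ⪯₊ Γ`: `vᵀ C v ≤ vᵀ Γ v` for all vectors with non-negative coordinates. -/
def PosLE (C Γ : Matrix (Fin d) (Fin d) ℝ) : Prop :=
  ∀ v : Fin d → ℝ, (∀ i, 0 ≤ v i) → v ⬝ᵥ (C.mulVec v) ≤ v ⬝ᵥ (Γ.mulVec v)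

/-- `a` is a best action of the action set `𝒜`. -/
def IsBest (𝒜 : Finset (Finset (Fin d))) (μ : Fin d → ℝ) (a : Finset (Fin d)) : Prop :=
  a ∈ 𝒜 ∧ ∀ S ∈ 𝒜, reward μ S ≤ reward μ a

/-- The gap of the action `S`, with `a` a best action. -/
def gap (μ : Fin d → ℝ) (a S : Finset (Fin d)) : ℝ := reward μ a - reward μ S

/-- `D_t = ∑_{s<t} I_{A_s}`, the diagonal matrix of the numbers of pulls before stage `t`, where
`A s` is the action of stage `s`. -/
def pullMat (A : ℕ → Finset (Fin d)) (t : ℕ) : Matrix (Fin d) (Fin d) ℝ :=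
  ∑ s ∈ Finset.Ico 1 t, actionMat (A s)

/-- The empirical (ordinary least squares) mean `μ̂_t` of each arm before stage `t`. -/
def empMean (A : ℕ → Finset (Fin d)) (x : ℕ → Fin d → ℝ) (t : ℕ) (i : Fin d) : ℝ :=
  (∑ s ∈ Finset.Ico 1 t with i ∈ A s, x s i) / (((Finset.Ico 1 t).filter (fun s => i ∈ A s)).card : ℝ)

/-- The exploration function
`f(t) = log t + (m+2) log log t + (m/2) log (1 + e/lam)`. -/
def explorationFn (m : ℕ) (lam : ℝ) (t : ℕ) : ℝ :=
  Real.log t + ((m : ℝ) + 2) * Real.log (Real.log t)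
    + (m : ℝ) / 2 * Real.log (1 + Real.exp 1 / lam)

/-- The exploration term
`E_t(S) = √(2 f(t)) √(Sᵀ D_t⁻¹ (lam Σ_Γ D_t + ∑_{s<t} Γ_{A_s}) D_t⁻¹ S)`, where `Σ_Γ` is the
diagonal matrix with the same diagonal as `Γ`. -/
def explorationTerm (m : ℕ) (Γ : Matrix (Fin d) (Fin d) ℝ) (lam : ℝ)
    (A : ℕ → Finset (Fin d)) (t : ℕ) (S : Finset (Fin d)) : ℝ :=
  Real.sqrt (2 * explorationFn m lam t) *
    Real.sqrt (actionVec S ⬝ᵥ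
      (((pullMat A t)⁻¹ *
          (lam • (Matrix.diagonal Γ.diag * pullMat A t)
            + ∑ s ∈ Finset.Ico 1 t, restrict Γ (A s)) *
          (pullMat A t)⁻¹).mulVec (actionVec S)))

/-- The index `Sᵀ μ̂_t + E_t(S)` maximized by OLS-UCB at stage `t`. -/
def ucbIndex (m : ℕ) (Γ : Matrix (Fin d) (Fin d) ℝ) (lam : ℝ)
    (A : ℕ → Finset (Fin d)) (x : ℕ → Fin d → ℝ) (t : ℕ) (S : Finset (Fin d)) : ℝ :=
  reward (empMean A x t) S + explorationTerm m Γ lam A t S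

/-- The maximal off-diagonal correlation coefficient of `Γ_S`. The set is finite, so the supremum
is a maximum; it is `0` if `S` has fewer than two elements. -/
def corr (Γ : Matrix (Fin d) (Fin d) ℝ) (S : Finset (Fin d)) : ℝ :=
  sSup {r : ℝ | ∃ i ∈ S, ∃ j ∈ S, i ≠ j ∧ r = Γ i j / Real.sqrt (Γ i i * Γ j j)}

/-- The maximum, over the stages `t = 1, …, T`, of the correlation coefficients of `Γ_{A_t}`. -/
def maxCorr (Γ : Matrix (Fin d) (Fin d) ℝ) (A : ℕ → Finset (Fin d)) (T : ℕ) : ℝ :=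
  sSup {r : ℝ | ∃ t ∈ Finset.Icc 1 T, r = corr Γ (A t)}

/-- The smallest positive integer greater than or equal to `log m / 1.6`. -/
def ceilLog (m : ℕ) : ℕ := max 1 ⌈Real.log m / 1.6⌉₊

variable {Ω : Type*} [mΩ : MeasurableSpace Ω]

/-- The environment: reward vectors `X 1, X 2, …` adapted to the filtration `ℱ`, each independent
of the past (so that they are i.i.d.), with mean `μ` and subgaussian covariance matrix `C`. The
σ-algebra `ℱ t` contains everything that happened up to stage `t`, including the internal
randomization used by the algorithm to select the action of stage `t + 1`. -/
structure IsEnvironment (P : Measure Ω) (ℱ : Filtration ℕ mΩ) (C : Matrix (Fin d) (Fin d) ℝ)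
    (μ : Fin d → ℝ) (X : ℕ → Ω → Fin d → ℝ) : Prop where
  measurable : ∀ t, 1 ≤ t → Measurable[ℱ t] (X t)
  indep : ∀ t, Indep (MeasurableSpace.comap (X (t + 1)) inferInstance) (ℱ t) P
  identDistrib : ∀ t, 1 ≤ t → IdentDistrib (X t) (X 1) P P
  integrable : ∀ i, Integrable (fun ω => X 1 ω i) P
  mean : ∀ i, ∫ ω, X 1 ω i ∂P = μ i
  integrable_exp : ∀ u : Fin d → ℝ, Integrable (fun ω => Real.exp (u ⬝ᵥ (X 1 ω - μ))) P
  subgaussian : ∀ u : Fin d → ℝ,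
    ∫ ω, Real.exp (u ⬝ᵥ (X 1 ω - μ)) ∂P ≤ Real.exp (1 / 2 * (u ⬝ᵥ (C.mulVec u)))

/-- `A 1, A 2, …` are the actions of OLS-UCB with matrix `Γ`, parameter `lam`, an initialization of
`N` stages and action set `𝒜`, on the rewards `X`: every arm is pulled at least once in the first
`N` stages, and afterwards an action of maximal index is played. The actions of the initialization
and the way ties are broken are arbitrary, possibly random, but must not anticipate the rewards. -/
structure IsOLSUCB (ℱ : Filtration ℕ mΩ) (m : ℕ) (Γ : Matrix (Fin d) (Fin d) ℝ) (lam : ℝ) (N : ℕ)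
    (𝒜 : Finset (Finset (Fin d))) (X : ℕ → Ω → Fin d → ℝ) (A : ℕ → Ω → Finset (Fin d)) :
    Prop where
  mem : ∀ t, 1 ≤ t → ∀ ω, A t ω ∈ 𝒜
  predictable : ∀ t S, MeasurableSet[ℱ t] {ω | A (t + 1) ω = S}
  init : ∀ ω i, ∃ t ∈ Finset.Icc 1 N, i ∈ A t ω
  argmax : ∀ t, N < t → ∀ ω, ∀ S ∈ 𝒜,
    ucbIndex m Γ lam (fun s => A s ω) (fun s => X s ω) t S
      ≤ ucbIndex m Γ lam (fun s => A s ω) (fun s => X s ω) t (A t ω)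

/-- The expected regret up to stage `T`, with `a` a best action. -/
def expectedRegret (P : Measure Ω) (μ : Fin d → ℝ) (a : Finset (Fin d))
    (A : ℕ → Ω → Finset (Fin d)) (T : ℕ) : ℝ :=
  ∫ ω, ∑ t ∈ Finset.Icc 1 T, gap μ a (A t ω) ∂P

end SemiBandit

end

noncomputable section

namespace SemiBandit

/-! The proof is the optimism argument: on an event where every estimated reward is within its
exploration term of the truth, the gap of the chosen action is at most twice its own exploration
term. What remains is to bound the probability of the bad events and to sum the widths.

Concentration. For a fixed vector `u` with non-negative coordinates, or its opposite, the
exponential of `expStat` has expectation at most one (`lintegral_exp_expStat_le`), so Markov's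
inequality applies. The vector that one would like to use depends on the random pull counts; it is
replaced by a vector of a deterministic geometric net with polylogarithmically many points in `t`,
and a union bound is taken. Rounding down keeps the vectors non-negative, which is all that `PosLE`
handles, and does not increase the quadratic form, since `Γ` has non-negative coefficients. The
rounding error is controlled arm by arm (`abs_coord_le`) and is paid for by the regularization `lam
Σ_Γ D_t` (`abs_weighted_noise_le`). The level `(3/4) log t` is enough for deviations `√(2 log t)
√confWidth`, below the exploration term because `log t ≤ f(t)`. Bad events then have probability at
most `1/√t`: not summable, but their total cost is at most of order `B √T`, which the factor `√(log
T)` of the target absorbs once `T` is large. Hence `T₀` need not depend on the gaps.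

Widths. With `n_i` the pull counts, `G` the largest diagonal coefficient of `Γ` and `γ` the maximal
correlation, `confWidth_le_corr` bounds the width by `G (lam+1-γ) ∑ 1/n_i + G γ (∑ 1/√n_i)²`. Square
roots of the second part sum to order `√(G γ d T m)`. For the first, splitting the arms at `n_i =
T/d` gives order `√(d T)` times `√(log (1+m)) + 1`, without any `log T`
(`sum_sqrt_sum_inv_pulls_le`). The only `log T` comes from the exploration function. -/

variable {d : ℕ}

/-! ### Pull counts and sums along the pulls. -/

/-- The number of pulls of each arm before stage `t`. -/
def pulls (A : ℕ → Finset (Fin d)) (t : ℕ) (i : Fin d) : ℕ :=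
  ((Finset.Ico 1 t).filter (fun s => i ∈ A s)).card

lemma pulls_succ (A : ℕ → Finset (Fin d)) {t : ℕ} (ht : 1 ≤ t) (i : Fin d) :
    pulls A (t + 1) i = pulls A t i + if i ∈ A t then 1 else 0 := by
  unfold pulls
  rw [Nat.Ico_succ_right_eq_insert_Ico ht, Finset.filter_insert]
  split_ifs with h
  · rw [Finset.card_insert_of_notMem (by simp)]
  · simp

lemma pulls_le (A : ℕ → Finset (Fin d)) (t : ℕ) (i : Fin d) : pulls A t i ≤ t := by
  refine (Finset.card_filter_le _ _).trans ?_
  simp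

lemma sum_pulls (A : ℕ → Finset (Fin d)) {m : ℕ} (hA : ∀ t, 1 ≤ t → (A t).card = m) (T : ℕ) :
    ∑ i, pulls A (T + 1) i = m * T := by
  induction T with
  | zero => simp [pulls]
  | succ T ih =>
    have := hA (T + 1) (by omega)
    simp [pulls_succ A (show 1 ≤ T + 1 by omega), Finset.sum_add_distrib, ih, this, mul_add]

/-- A sum along the pulls of one arm is bounded by a potential of the final number of pulls. -/
lemma sum_pulls_le_potential (A : ℕ → Finset (Fin d)) (i : Fin d) (φ Ψ : ℕ → ℝ)
    (h0 : 0 ≤ Ψ 0) (hmono : ∀ n, Ψ n ≤ Ψ (n + 1))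
    (hstep : ∀ n, 1 ≤ n → φ n ≤ Ψ (n + 1) - Ψ n) (T : ℕ) :
    ∑ t ∈ Finset.Icc 1 T, (if i ∈ A t ∧ 1 ≤ pulls A t i then φ (pulls A t i) else 0)
      ≤ Ψ (pulls A (T + 1) i) := by
  induction T with
  | zero => simpa [pulls] using h0
  | succ T ih =>
    rw [Finset.sum_Icc_succ_top (by omega), pulls_succ A (show 1 ≤ T + 1 by omega) i]
    by_cases h : i ∈ A (T + 1)
    · by_cases h1 : 1 ≤ pulls A (T + 1) i
      · have := hstep _ h1
        simp only [h, h1, and_self, if_true]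
        linarith
      -- The very first pull of the arm, from count zero, contributes nothing to the sum;
      -- monotonicity of the potential suffices.
      · have := hmono (pulls A (T + 1) i)
        simp only [h, h1, and_false, if_false, if_true]
        linarith
    · simp only [h, false_and, if_false, add_zero]
      linarith

/-- The difference of roots is `1 / (√(n+1) + √n)`, and `√(n+1) ≤ 2√n` when `n ≥ 1`. -/
lemma inv_sqrt_le_sqrt_succ_sub {n : ℕ} (hn : 1 ≤ n) :
    1 / √(n : ℝ) ≤ 3 * √((n + 1 : ℕ) : ℝ) - 3 * √(n : ℝ) := by
  have hn' : (1 : ℝ) ≤ n := by exact_mod_cast hn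
  have h1 : 0 < √(n : ℝ) := Real.sqrt_pos.2 (by linarith)
  have e1 := Real.sq_sqrt (show (0 : ℝ) ≤ n by linarith)
  have e2 := Real.sq_sqrt (show (0 : ℝ) ≤ ((n + 1 : ℕ) : ℝ) by positivity)
  push_cast at *
  set a := √(n : ℝ)
  set b := √((n : ℝ) + 1)
  have hb0 : 0 ≤ b := Real.sqrt_nonneg _
  have hb : a ≤ b := by
    apply Real.sqrt_le_sqrt; linarith
  have hb2 : b ≤ 2 * a := by nlinarith
  rw [div_le_iff₀ h1]
  nlinarith

/-- The logarithm increases by at least `1 / (L + n + 1)`, and `L + n + 1 ≤ 3n` beyond the threshold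
`L`. The shift by `L` makes the potential vanish at zero and grow only like `log (n / L)`. -/
lemma inv_le_log_sub {L : ℝ} (hL : 0 < L) {n : ℕ} (hn : 1 ≤ n) (hLn : L < n) :
    1 / (n : ℝ) ≤ 3 * Real.log (1 + ((n + 1 : ℕ) : ℝ) / L) - 3 * Real.log (1 + (n : ℝ) / L) := by
  have hn' : (1 : ℝ) ≤ n := by exact_mod_cast hn
  rw [← mul_sub, ← Real.log_div (by positivity) (by positivity)]
  have e : (1 + ((n + 1 : ℕ) : ℝ) / L) / (1 + (n : ℝ) / L) = (L + n + 1) / (L + n) := by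
    push_cast; field_simp; ring
  rw [e]
  have h := Real.one_sub_inv_le_log_of_pos (show 0 < (L + n + 1) / (L + n) by positivity)
  have : 1 - ((L + n + 1) / (L + n))⁻¹ = 1 / (L + n + 1) := by field_simp; ring
  rw [this] at h
  have : 1 / (n : ℝ) ≤ 3 * (1 / (L + n + 1)) := by
    rw [mul_one_div, div_le_div_iff₀ (by positivity) (by positivity)]; linarith
  linarith

/-- Concavity: the logarithm lies below its tangent at `1 + m`. -/
lemma sum_log_le (d m : ℕ) {ι : Type*} (s : Finset ι) (hs : s.card = d) (x : ι → ℝ)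
    (hx : ∀ i ∈ s, 0 ≤ x i) (hsum : ∑ i ∈ s, x i ≤ m * d) :
    ∑ i ∈ s, Real.log (1 + x i) ≤ d * Real.log (1 + m) := by
  have hm : (0 : ℝ) < 1 + m := by positivity
  have key : ∀ i ∈ s, Real.log (1 + x i) ≤ Real.log (1 + m) + (x i - m) / (1 + m) := by
    intro i hi
    have h := Real.log_le_sub_one_of_pos
      (show 0 < (1 + x i) / (1 + m) by have := hx i hi; positivity)
    rw [Real.log_div (by have := hx i hi; positivity) hm.ne'] at h
    have e : (1 + x i) / (1 + (m : ℝ)) - 1 = (x i - m) / (1 + m) := by field_simp; ring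
    linarith
  refine (Finset.sum_le_sum key).trans ?_
  rw [Finset.sum_add_distrib, ← Finset.sum_div, Finset.sum_sub_distrib]
  simp only [Finset.sum_const, hs, nsmul_eq_mul]
  have : (∑ i ∈ s, x i - d * m) / (1 + (m : ℝ)) ≤ 0 :=
    div_nonpos_of_nonpos_of_nonneg (by linarith) hm.le
  linarith

lemma sqrt_add_le_sqrt_add_sqrt {x y : ℝ} (hx : 0 ≤ x) (hy : 0 ≤ y) : √(x + y) ≤ √x + √y := by
  rw [Real.sqrt_le_left (by positivity), add_sq, Real.sq_sqrt hx, Real.sq_sqrt hy]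
  have : 0 ≤ √x * √y := by positivity
  linarith

lemma sqrt_sum_le_sum_sqrt {ι : Type*} (s : Finset ι) (x : ι → ℝ) (hx : ∀ i ∈ s, 0 ≤ x i) :
    √(∑ i ∈ s, x i) ≤ ∑ i ∈ s, √(x i) := by
  classical
  induction s using Finset.induction_on with
  | empty => simp
  | insert a s ha ih =>
    rw [Finset.sum_insert ha, Finset.sum_insert ha]
    refine (sqrt_add_le_sqrt_add_sqrt (hx a (by simp)) (Finset.sum_nonneg fun i hi => hx i (by simp [hi]))).trans ?_
    have := ih (fun i hi => hx i (by simp [hi]))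
    linarith

lemma sum_sqrt_le {ι : Type*} (s : Finset ι) (x : ι → ℝ) (hx : ∀ i ∈ s, 0 ≤ x i) :
    ∑ i ∈ s, √(x i) ≤ √(s.card * ∑ i ∈ s, x i) := by
  apply Real.le_sqrt_of_sq_le
  refine (sq_sum_le_card_mul_sum_sq).trans ?_
  apply le_of_eq
  congr 1
  exact Finset.sum_congr rfl fun i hi => Real.sq_sqrt (hx i hi)

section
variable (A : ℕ → Finset (Fin d)) {m N T : ℕ}

/-- Sums of a function of the number of pulls over the arms played after the initialization. -/
lemma sum_arms_le_potential (hN : ∀ t, N < t → ∀ i, 1 ≤ pulls A t i)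
    (φ Ψ : ℕ → ℝ) (hφ : ∀ n, 0 ≤ φ n)
    (h0 : 0 ≤ Ψ 0) (hmono : ∀ n, Ψ n ≤ Ψ (n + 1))
    (hstep : ∀ n, 1 ≤ n → φ n ≤ Ψ (n + 1) - Ψ n) :
    ∑ t ∈ Finset.Ioc N T, ∑ i ∈ A t, φ (pulls A t i) ≤ ∑ i, Ψ (pulls A (T + 1) i) := by
  refine le_trans ?_ (Finset.sum_le_sum fun i _ =>
    sum_pulls_le_potential A i φ Ψ h0 hmono hstep T)
  rw [Finset.sum_comm]
  calc ∑ t ∈ Finset.Ioc N T, ∑ i ∈ A t, φ (pulls A t i)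
      = ∑ t ∈ Finset.Ioc N T, ∑ i,
          (if i ∈ A t ∧ 1 ≤ pulls A t i then φ (pulls A t i) else 0) := by
        refine Finset.sum_congr rfl fun t ht => ?_
        have h1 := hN t (Finset.mem_Ioc.1 ht).1
        simp [h1, Finset.sum_ite_mem]
    _ ≤ _ := by
        refine Finset.sum_le_sum_of_subset_of_nonneg ?_ ?_
        · intro t ht
          simp only [Finset.mem_Ioc, Finset.mem_Icc] at *
          omega
        · intro t _ _
          refine Finset.sum_nonneg fun i _ => ?_
          split_ifs
          · exact hφ _
          · exact le_rfl

lemma sum_inv_sqrt_pulls_le (hA : ∀ t, 1 ≤ t → (A t).card = m)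
    (hN : ∀ t, N < t → ∀ i, 1 ≤ pulls A t i) :
    ∑ t ∈ Finset.Ioc N T, ∑ i ∈ A t, 1 / √(pulls A t i : ℝ) ≤ 3 * √(d * T * m) := by
  refine (sum_arms_le_potential A hN (fun n => 1 / √(n : ℝ)) (fun n => 3 * √(n : ℝ))
    (fun n => by positivity) (by simp) (fun n => ?_)
    (fun n hn => inv_sqrt_le_sqrt_succ_sub hn)).trans ?_
  · push_cast
    have : √(n : ℝ) ≤ √((n : ℝ) + 1) := Real.sqrt_le_sqrt (by linarith)
    linarith
  · rw [← Finset.mul_sum]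
    refine mul_le_mul_of_nonneg_left ((sum_sqrt_le _ _ fun i _ => by positivity).trans ?_)
      (by norm_num)
    have := sum_pulls A hA T
    rw [← Nat.cast_sum, this]
    simp only [Finset.card_univ, Fintype.card_fin, Nat.cast_mul]
    apply le_of_eq; congr 1; ring

/-- Arms are split according to whether their count exceeds `T / d`. Frequent arms go through
Cauchy–Schwarz over the stages and a logarithmic potential, rare arms through the cruder bound of
the root of a sum by the sum of the roots. A single Cauchy–Schwarz would cost a factor `√(log T)`.
-/
lemma sum_sqrt_sum_inv_pulls_le (hd : 1 ≤ d) (hT : d ≤ T)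
    (hA : ∀ t, 1 ≤ t → (A t).card = m)
    (hN : ∀ t, N < t → ∀ i, 1 ≤ pulls A t i) :
    ∑ t ∈ Finset.Ioc N T, √(∑ i ∈ A t, 1 / (pulls A t i : ℝ))
      ≤ √(d * T) * (√(3 * Real.log (1 + m)) + 5) := by
  have hd' : (1 : ℝ) ≤ d := by exact_mod_cast hd
  have hT' : (d : ℝ) ≤ T := by exact_mod_cast hT
  set L : ℝ := T / d with hL
  have hL1 : 1 ≤ L := by rw [hL, le_div_iff₀ (by linarith)]; linarith
  have hL0 : 0 < L := by linarith
  let φ₁ : ℕ → ℝ := fun n => if L < n then 1 / (n : ℝ) else 0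
  let φ₂ : ℕ → ℝ := fun n => if L < n then 0 else 1 / √(n : ℝ)
  have hφ₁ : ∀ n, 0 ≤ φ₁ n := fun n => by dsimp only [φ₁]; split_ifs <;> positivity
  have hφ₂ : ∀ n, 0 ≤ φ₂ n := fun n => by dsimp only [φ₂]; split_ifs <;> positivity
  have hsplit : ∀ t ∈ Finset.Ioc N T, √(∑ i ∈ A t, 1 / (pulls A t i : ℝ))
      ≤ √(∑ i ∈ A t, φ₁ (pulls A t i)) + ∑ i ∈ A t, φ₂ (pulls A t i) := by
    intro t _
    have e : ∀ i, 1 / (pulls A t i : ℝ) = φ₁ (pulls A t i) + (φ₂ (pulls A t i)) ^ 2 := by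
      intro i
      dsimp only [φ₁, φ₂]
      split_ifs
      · simp
      · rw [div_pow, Real.sq_sqrt (by positivity)]; simp
    simp_rw [e, Finset.sum_add_distrib]
    refine (sqrt_add_le_sqrt_add_sqrt (Finset.sum_nonneg fun i _ => hφ₁ _)
      (Finset.sum_nonneg fun i _ => sq_nonneg _)).trans ?_
    gcongr
    refine (sqrt_sum_le_sum_sqrt _ _ fun i _ => sq_nonneg _).trans (le_of_eq ?_)
    exact Finset.sum_congr rfl fun i _ => Real.sqrt_sq (hφ₂ _)
  refine (Finset.sum_le_sum hsplit).trans ?_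
  rw [Finset.sum_add_distrib]
  have b1 : ∑ t ∈ Finset.Ioc N T, ∑ i ∈ A t, φ₁ (pulls A t i) ≤ 3 * (d * Real.log (1 + m)) := by
    refine (sum_arms_le_potential A hN φ₁ (fun n => 3 * Real.log (1 + (n : ℝ) / L)) hφ₁
      (by simp) (fun n => ?_) (fun n hn => ?_)).trans ?_
    · push_cast
      gcongr
      linarith
    · dsimp only [φ₁]
      split_ifs with h
      · exact inv_le_log_sub hL0 hn h
      · push_cast
        rw [sub_nonneg]
        gcongr
        linarith
    · rw [← Finset.mul_sum]
      refine mul_le_mul_of_nonneg_left (sum_log_le d m _ (by simp) _ (fun i _ => by positivity) ?_)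
        (by norm_num)
      -- The counts sum to `m T`, so after division by `L = T / d` they sum to `m d`: this choice of
      -- threshold leaves only `log (1 + m)`.
      rw [← Finset.sum_div, ← Nat.cast_sum, sum_pulls A hA T, hL]
      have : (0 : ℝ) < T := by linarith
      apply le_of_eq; push_cast; field_simp
  have b2 : ∑ t ∈ Finset.Ioc N T, ∑ i ∈ A t, φ₂ (pulls A t i) ≤ d * (3 * √(L + 1)) := by
    have hmono : ∀ n : ℕ, √(n : ℝ) ≤ √((n + 1 : ℕ) : ℝ) := fun n =>
      Real.sqrt_le_sqrt (by push_cast; linarith)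
    -- The potential is capped, since an arm stops contributing once its count exceeds `L`; the last
    -- contributing pull leads to a count of at most `L + 1`.
    refine (sum_arms_le_potential A hN φ₂ (fun n => min (3 * √(n : ℝ)) (3 * √(L + 1))) hφ₂
      (by simp) (fun n => ?_) (fun n hn => ?_)).trans ?_
    · have := hmono n
      gcongr
    · dsimp only [φ₂]
      split_ifs with h
      · rw [sub_nonneg]
        have := hmono n
        gcongr
      · push Not at h
        rw [min_eq_left, min_eq_left]
        · exact inv_sqrt_le_sqrt_succ_sub hn
        · gcongr; linarith
        · gcongr; push_cast; linarith
    · refine (Finset.sum_le_sum fun i _ => min_le_right _ _).trans (le_of_eq ?_)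
      simp
  have b3 : ∑ t ∈ Finset.Ioc N T, √(∑ i ∈ A t, φ₁ (pulls A t i))
      ≤ √(d * T) * √(3 * Real.log (1 + m)) := by
    refine (sum_sqrt_le _ _ fun t _ => Finset.sum_nonneg fun i _ => hφ₁ _).trans ?_
    rw [← Real.sqrt_mul (by positivity)]
    apply Real.sqrt_le_sqrt
    have : ((Finset.Ioc N T).card : ℝ) ≤ T := by
      rw [Nat.card_Ioc]; exact_mod_cast Nat.sub_le _ _
    calc _ ≤ (T : ℝ) * (3 * (d * Real.log (1 + m))) :=
          mul_le_mul this b1 (Finset.sum_nonneg fun t _ => Finset.sum_nonneg fun i _ => hφ₁ _)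
            (by positivity)
      _ = _ := by ring
  have b4 : (d : ℝ) * (3 * √(L + 1)) ≤ √(d * T) * 5 := by
    have e : (d : ℝ) * T = d ^ 2 * L := by rw [hL]; field_simp
    rw [e, Real.sqrt_mul (by positivity), Real.sqrt_sq (by linarith)]
    have : 3 * √(L + 1) ≤ √L * 5 := by
      apply abs_le_of_sq_le_sq' _ (by positivity) |>.2
      rw [mul_pow, mul_pow, Real.sq_sqrt hL0.le, Real.sq_sqrt (by linarith)]
      linarith
    nlinarith
  linarith

end

/-! ### Noise, quadratic forms and the index in coordinates. -/

/-- The vector `u` with the coordinates outside `S` set to zero. -/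
def mask (u : Fin d → ℝ) (S : Finset (Fin d)) : Fin d → ℝ := fun i => if i ∈ S then u i else 0

/-- The number of stages before `t` at which both `i` and `j` are pulled. -/
def pairPulls (A : ℕ → Finset (Fin d)) (t : ℕ) (i j : Fin d) : ℕ :=
  ((Finset.Ico 1 t).filter (fun s => i ∈ A s ∧ j ∈ A s)).card

/-- The centred sum of the rewards of each arm observed before stage `t`. -/
def noise (A : ℕ → Finset (Fin d)) (x : ℕ → Fin d → ℝ) (μ : Fin d → ℝ) (t : ℕ) (i : Fin d) : ℝ :=
  ∑ s ∈ Finset.Ico 1 t with i ∈ A s, (x s i - μ i)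

/-- The quadratic form `uᵀ (∑_{s<t} Γ_{A_s}) u`. -/
def quadForm (Γ : Matrix (Fin d) (Fin d) ℝ) (A : ℕ → Finset (Fin d)) (t : ℕ) (u : Fin d → ℝ) : ℝ :=
  ∑ s ∈ Finset.Ico 1 t, mask u (A s) ⬝ᵥ Γ.mulVec (mask u (A s))

/-- The logarithm of the exponential supermartingale attached to the vector `u`. -/
def expStat (Γ : Matrix (Fin d) (Fin d) ℝ) (μ u : Fin d → ℝ) (A : ℕ → Finset (Fin d))
    (x : ℕ → Fin d → ℝ) (t : ℕ) : ℝ :=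
  ∑ s ∈ Finset.Ico 1 t, (mask u (A s) ⬝ᵥ (x s - μ)
    - 1 / 2 * (mask u (A s) ⬝ᵥ Γ.mulVec (mask u (A s))))

/-- Regrouping by arm turns a bound on the martingale exponent into a bound on the noise vector. -/
lemma expStat_eq (Γ : Matrix (Fin d) (Fin d) ℝ) (μ u : Fin d → ℝ) (A : ℕ → Finset (Fin d))
    (x : ℕ → Fin d → ℝ) (t : ℕ) :
    expStat Γ μ u A x t = ∑ i, u i * noise A x μ t i - 1 / 2 * quadForm Γ A t u := by
  unfold expStat quadForm noise
  rw [Finset.sum_sub_distrib, ← Finset.mul_sum]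
  congr 1
  simp only [dotProduct, Finset.mul_sum, Finset.sum_filter]
  rw [Finset.sum_comm]
  refine Finset.sum_congr rfl fun i _ => Finset.sum_congr rfl fun s _ => ?_
  simp [mask]

lemma quadForm_eq (Γ : Matrix (Fin d) (Fin d) ℝ) (A : ℕ → Finset (Fin d)) (t : ℕ) (u : Fin d → ℝ) :
    quadForm Γ A t u = ∑ i, ∑ j, u i * u j * Γ i j * pairPulls A t i j := by
  unfold quadForm pairPulls
  simp only [dotProduct, Matrix.mulVec, Finset.mul_sum]
  rw [Finset.sum_comm]
  refine Finset.sum_congr rfl fun i _ => ?_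
  rw [Finset.sum_comm]
  refine Finset.sum_congr rfl fun j _ => ?_
  rw [Finset.card_filter]
  push_cast
  rw [Finset.mul_sum]
  refine Finset.sum_congr rfl fun s _ => ?_
  by_cases hi : i ∈ A s <;> by_cases hj : j ∈ A s <;> simp [mask, hi, hj]
  ring

lemma quadForm_neg (Γ : Matrix (Fin d) (Fin d) ℝ) (A : ℕ → Finset (Fin d)) (t : ℕ) (u : Fin d → ℝ) :
    quadForm Γ A t (-u) = quadForm Γ A t u := by
  simp [quadForm_eq]

lemma pairPulls_self (A : ℕ → Finset (Fin d)) (t : ℕ) (i : Fin d) :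
    pairPulls A t i i = pulls A t i := by
  simp [pairPulls, pulls]

lemma pairPulls_le_left (A : ℕ → Finset (Fin d)) (t : ℕ) (i j : Fin d) :
    pairPulls A t i j ≤ pulls A t i :=
  Finset.card_le_card (Finset.monotone_filter_right _ fun _ _ h => h.1)

lemma pairPulls_le_right (A : ℕ → Finset (Fin d)) (t : ℕ) (i j : Fin d) :
    pairPulls A t i j ≤ pulls A t j :=
  Finset.card_le_card (Finset.monotone_filter_right _ fun _ _ h => h.2)

lemma quadForm_smul (Γ : Matrix (Fin d) (Fin d) ℝ) (A : ℕ → Finset (Fin d)) (t : ℕ) (c : ℝ)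
    (u : Fin d → ℝ) : quadForm Γ A t (fun i => c * u i) = c ^ 2 * quadForm Γ A t u := by
  simp only [quadForm_eq, Finset.mul_sum]
  exact Finset.sum_congr rfl fun i _ => Finset.sum_congr rfl fun j _ => by ring

lemma quadForm_single (Γ : Matrix (Fin d) (Fin d) ℝ) (A : ℕ → Finset (Fin d)) (t : ℕ) (i : Fin d)
    (c : ℝ) : quadForm Γ A t (Pi.single i c) = c ^ 2 * Γ i i * pulls A t i := by
  rw [quadForm_eq, Finset.sum_eq_single i, Finset.sum_eq_single i]
  · rw [Pi.single_eq_same, pairPulls_self]; ring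
  · intro j _ hj; simp [hj]
  · simp
  · intro j _ hj; simp [hj]
  · simp

lemma quadForm_nonneg {Γ : Matrix (Fin d) (Fin d) ℝ} (hΓ : ∀ i j, 0 ≤ Γ i j)
    (A : ℕ → Finset (Fin d)) (t : ℕ) {u : Fin d → ℝ} (hu : ∀ i, 0 ≤ u i) :
    0 ≤ quadForm Γ A t u := by
  rw [quadForm_eq]
  refine Finset.sum_nonneg fun i _ => Finset.sum_nonneg fun j _ => ?_
  have := hu i; have := hu j; have := hΓ i j
  positivity

/-- All coefficients of the form are non-negative. This is what allows rounding down to the net. -/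
lemma quadForm_mono {Γ : Matrix (Fin d) (Fin d) ℝ} (hΓ : ∀ i j, 0 ≤ Γ i j)
    (A : ℕ → Finset (Fin d)) (t : ℕ) {u v : Fin d → ℝ} (hu : ∀ i, 0 ≤ u i) (huv : ∀ i, u i ≤ v i) :
    quadForm Γ A t u ≤ quadForm Γ A t v := by
  rw [quadForm_eq, quadForm_eq]
  refine Finset.sum_le_sum fun i _ => Finset.sum_le_sum fun j _ => ?_
  have := hu i; have := hu j; have := hΓ i j; have := huv i; have := huv j
  have := (hu i).trans (huv i)
  gcongr

/-- The vector `D_t⁻¹ S`. -/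
def weights (A : ℕ → Finset (Fin d)) (t : ℕ) (S : Finset (Fin d)) : Fin d → ℝ :=
  fun i => if i ∈ S then 1 / (pulls A t i : ℝ) else 0

/-- The quadratic form `Sᵀ D_t⁻¹ (lam Σ_Γ D_t + ∑_{s<t} Γ_{A_s}) D_t⁻¹ S`. -/
def confWidth (Γ : Matrix (Fin d) (Fin d) ℝ) (lam : ℝ) (A : ℕ → Finset (Fin d)) (t : ℕ)
    (S : Finset (Fin d)) : ℝ :=
  lam * ∑ i ∈ S, Γ i i / (pulls A t i : ℝ) + quadForm Γ A t (weights A t S)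

lemma pullMat_eq (A : ℕ → Finset (Fin d)) (t : ℕ) :
    pullMat A t = Matrix.diagonal (fun i => (pulls A t i : ℝ)) := by
  ext i j
  rw [pullMat, Matrix.sum_apply]
  by_cases h : i = j
  · subst h
    simp [actionMat, actionVec, pulls]
  · simp [actionMat, h]

lemma pullMat_inv (A : ℕ → Finset (Fin d)) (t : ℕ) (h : ∀ i, 1 ≤ pulls A t i) :
    (pullMat A t)⁻¹ = Matrix.diagonal (fun i => 1 / (pulls A t i : ℝ)) := by
  rw [pullMat_eq]
  apply Matrix.inv_eq_left_inv
  rw [Matrix.diagonal_mul_diagonal, ← Matrix.diagonal_one]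
  congr 1
  ext i
  have : (pulls A t i : ℝ) ≠ 0 := by have := h i; positivity
  simp [this]

lemma actionMat_mulVec (S : Finset (Fin d)) (u : Fin d → ℝ) : (actionMat S).mulVec u = mask u S := by
  ext i
  simp [actionMat, Matrix.mulVec_diagonal, actionVec, mask]

/-- Every arm must have been pulled for `D_t` to be invertible; all matrices other than `Γ` are then
diagonal or restrictions. -/
lemma explorationTerm_eq (m : ℕ) (Γ : Matrix (Fin d) (Fin d) ℝ) (lam : ℝ)
    (A : ℕ → Finset (Fin d)) (t : ℕ) (S : Finset (Fin d)) (h : ∀ i, 1 ≤ pulls A t i) :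
    explorationTerm m Γ lam A t S
      = √(2 * explorationFn m lam t) * √(confWidth Γ lam A t S) := by
  unfold explorationTerm
  congr 2
  have hw : (pullMat A t)⁻¹.mulVec (actionVec S) = weights A t S := by
    rw [pullMat_inv A t h]
    ext i
    simp [Matrix.mulVec_diagonal, actionVec, weights]
  have hw' : Matrix.vecMul (actionVec S) (pullMat A t)⁻¹ = weights A t S := by
    rw [pullMat_inv A t h]
    ext i
    simp [Matrix.vecMul_diagonal, actionVec, weights]
  rw [← Matrix.mulVec_mulVec, hw, ← Matrix.mulVec_mulVec, Matrix.dotProduct_mulVec, hw',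
    Matrix.add_mulVec, dotProduct_add, Matrix.smul_mulVec, dotProduct_smul, smul_eq_mul]
  unfold confWidth
  congr 1
  · congr 1
    rw [pullMat_eq, Matrix.diagonal_mul_diagonal]
    simp only [dotProduct, Matrix.mulVec_diagonal, weights, Matrix.diag]
    rw [← Finset.sum_filter_add_sum_filter_not Finset.univ (fun i => i ∈ S)]
    rw [Finset.sum_eq_zero (s := Finset.univ.filter (fun i => ¬ i ∈ S))]
    · rw [add_zero]
      refine Finset.sum_congr (by simp) fun i hi => ?_
      have hi : i ∈ S := by simpa using hi
      have : (pulls A t i : ℝ) ≠ 0 := by have := h i; positivity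
      simp only [hi, if_true]
      field_simp
    · intro i hi
      have hi : ¬ i ∈ S := by simpa using hi
      simp [hi]
  · rw [Matrix.sum_mulVec, dotProduct_sum]
    unfold quadForm
    refine Finset.sum_congr rfl fun s _ => ?_
    unfold restrict
    rw [← Matrix.mulVec_mulVec, ← Matrix.mulVec_mulVec, actionMat_mulVec, actionMat_mulVec]
    simp only [dotProduct]
    refine Finset.sum_congr rfl fun i _ => ?_
    by_cases hi : i ∈ A s <;> simp [mask, hi]

lemma reward_empMean (A : ℕ → Finset (Fin d)) (x : ℕ → Fin d → ℝ) (μ : Fin d → ℝ) (t : ℕ)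
    (S : Finset (Fin d)) (h : ∀ i, 1 ≤ pulls A t i) :
    reward (empMean A x t) S = reward μ S + ∑ i ∈ S, 1 / (pulls A t i : ℝ) * noise A x μ t i := by
  have e : ∀ v : Fin d → ℝ, reward v S = ∑ i ∈ S, v i := by
    intro v; simp [reward, dotProduct, actionVec]
  rw [e, e, ← Finset.sum_add_distrib]
  refine Finset.sum_congr rfl fun i _ => ?_
  have h1 : (pulls A t i : ℝ) ≠ 0 := by have := h i; positivity
  have h2 : noise A x μ t i
      = ∑ s ∈ Finset.Ico 1 t with i ∈ A s, x s i - pulls A t i * μ i := by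
    unfold noise pulls
    rw [Finset.sum_sub_distrib]
    simp
  rw [h2]
  unfold empMean
  change _ / (pulls A t i : ℝ) = _
  field_simp
  ring

/-! ### The net and the deviation bounds it yields. -/

/-- A finite geometric grid of non-negative numbers. -/
def grid (ε : ℝ) (K : ℕ) : Finset ℝ :=
  insert 0 ((Finset.Icc (-(K : ℤ)) K).image fun k : ℤ => Real.exp (ε * k))

lemma grid_card_le (ε : ℝ) (K : ℕ) : (grid ε K).card ≤ 2 * K + 2 := by
  refine (Finset.card_insert_le _ _).trans ?_
  have := Finset.card_image_le (s := Finset.Icc (-(K : ℤ)) K) (f := fun k : ℤ => Real.exp (ε * k))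
  rw [Int.card_Icc] at this
  omega

lemma grid_nonneg {ε : ℝ} {K : ℕ} {v : ℝ} (hv : v ∈ grid ε K) : 0 ≤ v := by
  simp only [grid, Finset.mem_insert, Finset.mem_image] at hv
  rcases hv with rfl | ⟨k, _, rfl⟩
  · exact le_rfl
  · positivity

lemma zero_mem_grid (ε : ℝ) (K : ℕ) : (0 : ℝ) ∈ grid ε K := by simp [grid]

/-- The vectors with all coordinates in the grid. -/
def net (d : ℕ) (ε : ℝ) (K : ℕ) : Finset (Fin d → ℝ) := Fintype.piFinset fun _ => grid ε K

lemma net_card_le (d : ℕ) (ε : ℝ) (K : ℕ) : (net d ε K).card ≤ (2 * K + 2) ^ d := by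
  rw [net, Fintype.card_piFinset_const]
  exact Nat.pow_le_pow_left (grid_card_le ε K) d

lemma net_nonneg {ε : ℝ} {K : ℕ} {u : Fin d → ℝ} (hu : u ∈ net d ε K) (i : Fin d) : 0 ≤ u i :=
  grid_nonneg (Fintype.mem_piFinset.1 hu i)

/-- The largest power of `exp ε` below `v`. -/
def gridFloor (ε v : ℝ) : ℝ := Real.exp (ε * ⌊Real.log v / ε⌋)

lemma gridFloor_pos (ε v : ℝ) : 0 < gridFloor ε v := Real.exp_pos _

lemma gridFloor_le {ε v : ℝ} (hε : 0 < ε) (hv : 0 < v) : gridFloor ε v ≤ v := by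
  unfold gridFloor
  conv_rhs => rw [← Real.exp_log hv]
  apply Real.exp_le_exp.2
  have := Int.floor_le (Real.log v / ε)
  rw [le_div_iff₀ hε] at this
  linarith

lemma le_gridFloor {ε v : ℝ} (hε : 0 < ε) (hv : 0 < v) : v ≤ Real.exp ε * gridFloor ε v := by
  unfold gridFloor
  rw [← Real.exp_add]
  conv_lhs => rw [← Real.exp_log hv]
  apply Real.exp_le_exp.2
  have := Int.lt_floor_add_one (Real.log v / ε)
  rw [div_lt_iff₀ hε] at this
  linarith

lemma sub_gridFloor_le {ε v : ℝ} (hε : 0 < ε) (hv : 0 < v) : v - gridFloor ε v ≤ ε * v := by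
  have h := le_gridFloor hε hv
  have h2 : Real.exp (-ε) * v ≤ gridFloor ε v := by
    calc Real.exp (-ε) * v ≤ Real.exp (-ε) * (Real.exp ε * gridFloor ε v) := by gcongr
      _ = gridFloor ε v := by rw [← mul_assoc, ← Real.exp_add]; simp
  have h3 := Real.add_one_le_exp (-ε)
  nlinarith

/-- The slack of one in `K - 1` makes room for the floor of a negative exponent. -/
lemma gridFloor_mem {ε v : ℝ} {K : ℕ} (hε : 0 < ε) (h : |Real.log v| ≤ ε * (K - 1)) :
    gridFloor ε v ∈ grid ε K := by
  unfold gridFloor grid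
  refine Finset.mem_insert_of_mem (Finset.mem_image_of_mem (fun k : ℤ => Real.exp (ε * k)) ?_)
  rw [abs_le] at h
  have h1 : -(K : ℝ) + 1 ≤ Real.log v / ε := by rw [le_div_iff₀ hε]; nlinarith
  have h2 : Real.log v / ε ≤ K := by rw [div_le_iff₀ hε]; nlinarith
  rw [Finset.mem_Icc]
  constructor
  · rw [Int.le_floor]; push_cast; linarith
  · have := Int.floor_le (Real.log v / ε)
    have : ((⌊Real.log v / ε⌋ : ℤ) : ℝ) ≤ ((K : ℤ) : ℝ) := by push_cast; linarith
    exact_mod_cast this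

section
variable {Γ : Matrix (Fin d) (Fin d) ℝ} {A : ℕ → Finset (Fin d)} {t K : ℕ} {M : Fin d → ℝ}
  {δ ε : ℝ}

/-- The net contains multiples of basis vectors. Testing with `v e_i` gives `|M i| ≤ v g / 2 + δ /
v`, nearly minimal at the rounding of `√(2δ/g)`, which loses a factor at most `e ≤ 3`. -/
lemma abs_coord_le (hε : 0 < ε) (hε1 : ε ≤ 1) (hδ : 0 < δ)
    (hgood : ∀ u ∈ net d ε K, |∑ i, u i * M i| ≤ 1 / 2 * quadForm Γ A t u + δ)
    (i : Fin d) (hi : 0 < Γ i i) (hn : 1 ≤ pulls A t i)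
    (hlog : |Real.log (√(2 * δ / (Γ i i * pulls A t i)))| ≤ ε * (K - 1)) :
    |M i| ≤ 4 * √δ * √(Γ i i * pulls A t i) := by
  have hn' : (1 : ℝ) ≤ pulls A t i := by exact_mod_cast hn
  set g : ℝ := Γ i i * pulls A t i with hg
  have hg0 : 0 < g := by positivity
  set v₀ := √(2 * δ / g) with hv₀
  have hv₀0 : 0 < v₀ := by positivity
  set v := gridFloor ε v₀ with hv
  have hv0 : 0 < v := gridFloor_pos _ _
  have hle : v ≤ v₀ := gridFloor_le hε hv₀0
  have hge : v₀ ≤ 3 * v := by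
    refine (le_gridFloor hε hv₀0).trans ?_
    have : Real.exp ε ≤ 3 := (Real.exp_le_exp.2 hε1).trans (by linarith [Real.exp_one_lt_d9])
    gcongr
  have hmem : Pi.single i v ∈ net d ε K := by
    rw [net, Fintype.mem_piFinset]
    intro j
    by_cases h : j = i
    · subst h; simpa using gridFloor_mem hε hlog
    · simpa [h] using zero_mem_grid ε K
  have h := hgood _ hmem
  rw [quadForm_single, Finset.sum_eq_single i (fun j _ hj => by simp [hj]) (by simp)] at h
  rw [Pi.single_eq_same, abs_mul, abs_of_pos hv0] at h
  have e1 : v₀ * √g = √2 * √δ := by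
    rw [hv₀, ← Real.sqrt_mul (by positivity), ← Real.sqrt_mul (by positivity)]
    congr 1; field_simp
  have hsg : 0 < √g := Real.sqrt_pos.2 hg0
  have hsd : 0 < √δ := Real.sqrt_pos.2 hδ
  have e2 : √g ^ 2 = g := Real.sq_sqrt hg0.le
  have e3 : √δ ^ 2 = δ := Real.sq_sqrt hδ.le
  have e4 : √2 ^ 2 = 2 := Real.sq_sqrt (by norm_num)
  have h2 : √2 ≤ 1.5 := by rw [Real.sqrt_le_left] <;> norm_num
  have h3 : 1.4 ≤ √2 := by apply Real.le_sqrt_of_sq_le; norm_num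
  have h' : v * |M i| ≤ v * (1 / 2 * v * g) + δ := by
    rw [hg]; linarith
  have k1 : v * √g ≤ √2 * √δ := by rw [← e1]; gcongr
  have k2 : √2 * √δ ≤ 3 * (v * √g) := by rw [← e1, ← mul_assoc]; gcongr
  have k3 : v * (1 / 2 * v * g) ≤ v * (√2 / 2 * √δ * √g) := by
    have : v * g = (v * √g) * √g := by rw [mul_assoc, ← sq, e2]
    refine mul_le_mul_of_nonneg_left ?_ hv0.le
    nlinarith
  have k4 : δ ≤ v * (3 / √2 * √δ * √g) := by
    have : √2 * δ ≤ 3 * (v * √g) * √δ := by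
      nlinarith
    have h5 : v * (3 / √2 * √δ * √g) = (3 * (v * √g) * √δ) / √2 := by ring
    rw [h5, le_div_iff₀ (by positivity)]
    linarith
  have k5 : v * |M i| ≤ v * ((√2 / 2 + 3 / √2) * (√δ * √g)) := by
    nlinarith
  have k6 : √2 / 2 + 3 / √2 ≤ 4 := by
    have : 3 / √2 ≤ 3 / 1.4 := by gcongr
    linarith
  have k7 := le_of_mul_le_mul_left k5 hv0
  refine k7.trans ?_
  rw [mul_assoc]
  gcongr

/-- The vector `D_t⁻¹ S` is scaled so that its quadratic form is at most `2δ`, then rounded down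
into the net. The net bounds the main part by `2δ`. The relative rounding error `ε` meets the
coordinatewise bounds, and `∑ √(Γ i i / n_i) ≤ √(|S| Q / lam)` because `Q` contains the
regularization term: this is where `lam > 0` matters. -/
lemma abs_weighted_noise_le (hΓ : ∀ i j, 0 ≤ Γ i j) (hε : 0 < ε) (hδ : 0 < δ) {lam : ℝ}
    (hlam : 0 < lam)
    (hgood : ∀ u ∈ net d ε K, |∑ i, u i * M i| ≤ 1 / 2 * quadForm Γ A t u + δ)
    (hn : ∀ i, 1 ≤ pulls A t i)
    (hcoord : ∀ i, |M i| ≤ 4 * √δ * √(Γ i i * pulls A t i))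
    (S : Finset (Fin d)) (hQ : 0 < confWidth Γ lam A t S)
    (hlog : ∀ i, |Real.log (√(2 * δ / confWidth Γ lam A t S) * (1 / (pulls A t i : ℝ)))|
      ≤ ε * (K - 1)) :
    |∑ i ∈ S, 1 / (pulls A t i : ℝ) * M i|
      ≤ √δ * √(confWidth Γ lam A t S) * (√2 + 4 * ε * √(S.card / lam)) := by
  set Q := confWidth Γ lam A t S with hQdef
  have hn' : ∀ i, (0 : ℝ) < pulls A t i := fun i => by have := hn i; positivity
  set η := √(2 * δ / Q) with hη
  have hη0 : 0 < η := by positivity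
  have hη2 : η ^ 2 = 2 * δ / Q := Real.sq_sqrt (by positivity)
  let u : Fin d → ℝ := fun i => if i ∈ S then gridFloor ε (η * (1 / (pulls A t i : ℝ))) else 0
  have hu : u ∈ net d ε K := by
    rw [net, Fintype.mem_piFinset]
    intro i
    dsimp only [u]
    split_ifs
    · exact gridFloor_mem hε (hlog i)
    · exact zero_mem_grid _ _
  have hpos : ∀ i, 0 < η * (1 / (pulls A t i : ℝ)) := fun i => by have := hn' i; positivity
  have hle : ∀ i, u i ≤ η * weights A t S i := by
    intro i
    dsimp only [u, weights]
    split_ifs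
    · exact gridFloor_le hε (hpos i)
    · simp
  have hR : ∑ i ∈ S, Γ i i / (pulls A t i : ℝ) ≤ Q / lam := by
    rw [le_div_iff₀ hlam, hQdef]
    have := quadForm_nonneg hΓ A t (u := weights A t S)
      (fun i => by dsimp only [weights]; split_ifs <;> positivity)
    unfold confWidth
    linarith
  have hq : quadForm Γ A t u ≤ 2 * δ := by
    refine (quadForm_mono hΓ A t (net_nonneg hu) hle).trans ?_
    rw [quadForm_smul, hη2]
    have : quadForm Γ A t (weights A t S) ≤ Q := by
      rw [hQdef]
      unfold confWidth
      have : 0 ≤ ∑ i ∈ S, Γ i i / (pulls A t i : ℝ) :=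
        Finset.sum_nonneg fun i _ => div_nonneg (hΓ i i) (hn' i).le
      nlinarith
    calc 2 * δ / Q * quadForm Γ A t (weights A t S) ≤ 2 * δ / Q * Q := by gcongr
      _ = 2 * δ := by field_simp
  have h1 : |∑ i ∈ S, u i * M i| ≤ 2 * δ := by
    have h := hgood u hu
    have e : ∑ i, u i * M i = ∑ i ∈ S, u i * M i := by
      symm
      refine Finset.sum_subset (Finset.subset_univ _) fun i _ hi => ?_
      simp [u, hi]
    rw [e] at h
    linarith
  have h2 : |∑ i ∈ S, (η * (1 / (pulls A t i : ℝ)) - u i) * M i|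
      ≤ η * (√δ * √Q * (4 * ε * √(S.card / lam))) := by
    refine (Finset.abs_sum_le_sum_abs _ _).trans ?_
    have : ∀ i ∈ S, |(η * (1 / (pulls A t i : ℝ)) - u i) * M i|
        ≤ (4 * ε * η * √δ) * √(Γ i i / (pulls A t i : ℝ)) := by
      intro i hi
      have hp := hpos i
      have a1 : η * (1 / (pulls A t i : ℝ)) - u i ≤ ε * (η * (1 / (pulls A t i : ℝ))) := by
        simpa [u, hi] using sub_gridFloor_le hε hp
      have a2 : 0 ≤ η * (1 / (pulls A t i : ℝ)) - u i := by
        simpa [u, hi] using gridFloor_le hε hp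
      rw [abs_mul, abs_of_nonneg a2]
      calc _ ≤ ε * (η * (1 / (pulls A t i : ℝ))) * (4 * √δ * √(Γ i i * pulls A t i)) :=
            mul_le_mul a1 (hcoord i) (abs_nonneg _) (by positivity)
        _ = (4 * ε * η * √δ) * (√(Γ i i * pulls A t i) / (pulls A t i : ℝ)) := by ring
        _ = _ := by
            congr 1
            rw [Real.sqrt_mul (hΓ i i), Real.sqrt_div (hΓ i i), mul_div_assoc,
              Real.sqrt_div_self', mul_one_div]
    refine (Finset.sum_le_sum this).trans ?_
    rw [← Finset.mul_sum]
    have h3 : ∑ i ∈ S, √(Γ i i / (pulls A t i : ℝ)) ≤ √Q * √(S.card / lam) := by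
      refine (sum_sqrt_le _ _ fun i _ => div_nonneg (hΓ i i) (hn' i).le).trans ?_
      rw [← Real.sqrt_mul hQ.le]
      apply Real.sqrt_le_sqrt
      calc _ ≤ (S.card : ℝ) * (Q / lam) := by gcongr
        _ = _ := by ring
    calc _ ≤ (4 * ε * η * √δ) * (√Q * √(S.card / lam)) := by gcongr
      _ = _ := by ring
  have h3 : η * |∑ i ∈ S, 1 / (pulls A t i : ℝ) * M i|
      ≤ 2 * δ + η * (√δ * √Q * (4 * ε * √(S.card / lam))) := by
    rw [← abs_of_pos hη0, ← abs_mul, abs_of_pos hη0]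
    have e : η * ∑ i ∈ S, 1 / (pulls A t i : ℝ) * M i
        = ∑ i ∈ S, u i * M i + ∑ i ∈ S, (η * (1 / (pulls A t i : ℝ)) - u i) * M i := by
      rw [Finset.mul_sum, ← Finset.sum_add_distrib]
      exact Finset.sum_congr rfl fun i _ => by ring
    rw [e]
    exact (abs_add_le _ _).trans (add_le_add h1 h2)
  have h4 : 2 * δ = η * (√δ * √Q * √2) := by
    have : √δ * √Q * √2 = η * Q := by
      rw [hη, Real.sqrt_div (by positivity), Real.sqrt_mul (by norm_num)]
      have hs : √Q * √Q = Q := Real.mul_self_sqrt hQ.le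
      have : √Q ≠ 0 := by positivity
      field_simp
      nlinarith
    rw [this, ← mul_assoc, ← sq, hη2]
    field_simp
  refine le_of_mul_le_mul_left ?_ hη0
  calc _ ≤ _ := h3
    _ = _ := by rw [h4]; ring

end

/-! ### Choice of level, mesh and grid size. -/

lemma abs_log_le_of_sq {t x : ℝ} (ht : 1 ≤ t) (hx : 0 < x) (h1 : x ^ 2 ≤ t ^ 6)
    (h2 : 1 ≤ x ^ 2 * t ^ 6) : |Real.log x| ≤ 3 * Real.log t := by
  have a := Real.log_le_log (by positivity) h1
  have b := Real.log_le_log (by positivity) h2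
  rw [Real.log_mul (by positivity) (by positivity)] at b
  simp only [Real.log_pow, Real.log_one] at a b
  push_cast at a b
  rw [abs_le]
  constructor <;> linarith

/-- The confidence level of stage `t`. -/
def level (t : ℕ) : ℝ := 3 / 4 * Real.log t

/-- The half-width of the grid of stage `t`. -/
def gridSize (ε : ℝ) (t : ℕ) : ℕ := ⌈3 * Real.log t / ε⌉₊ + 1

/-- The mesh of the grid. -/
def mesh (m : ℕ) (lam : ℝ) : ℝ := min 1 (√(lam / m) / 20)

lemma mesh_pos {m : ℕ} (hm : 1 ≤ m) {lam : ℝ} (hlam : 0 < lam) : 0 < mesh m lam := by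
  unfold mesh; positivity

lemma le_gridSize {ε : ℝ} (hε : 0 < ε) (t : ℕ) :
    3 * Real.log t ≤ ε * ((gridSize ε t : ℝ) - 1) := by
  have := Nat.le_ceil (3 * Real.log t / ε)
  rw [div_le_iff₀ hε] at this
  unfold gridSize
  push_cast
  linarith

/-- A crude polynomial bound, needed only to keep the scaled vector within the range of the grid. -/
lemma confWidth_le {Γ : Matrix (Fin d) (Fin d) ℝ} {R : ℝ} (hR : ∀ i j, Γ i j ≤ R)
    (hR0 : 0 ≤ R) (hd : 1 ≤ d)
    {lam : ℝ} (hlam : 0 < lam) (A : ℕ → Finset (Fin d)) {t : ℕ} (ht : 1 ≤ t)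
    (hn : ∀ i, 1 ≤ pulls A t i) (S : Finset (Fin d)) :
    confWidth Γ lam A t S ≤ (lam + 1) * (d : ℝ) ^ 2 * R * t := by
  have hd' : (1 : ℝ) ≤ d := by exact_mod_cast hd
  have ht' : (1 : ℝ) ≤ t := by exact_mod_cast ht
  have hn' : ∀ i, (1 : ℝ) ≤ pulls A t i := fun i => by exact_mod_cast hn i
  have hinv : ∀ i, 1 / (pulls A t i : ℝ) ≤ 1 := fun i => by
    rw [div_le_one (by linarith [hn' i])]; exact hn' i
  have h1 : ∑ i ∈ S, Γ i i / (pulls A t i : ℝ) ≤ d * R := by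
    calc _ ≤ ∑ i ∈ S, R := Finset.sum_le_sum fun i _ => by
          rw [div_le_iff₀ (by linarith [hn' i])]
          have := hR i i; have := hn' i
          nlinarith
      _ = S.card * R := by simp
      _ ≤ d * R := by
          have : S.card ≤ d := by simpa using Finset.card_le_univ S
          gcongr
  have h2 : quadForm Γ A t (weights A t S) ≤ (d : ℝ) ^ 2 * R * t := by
    rw [quadForm_eq]
    calc _ ≤ ∑ i : Fin d, ∑ j : Fin d, R * t := by
          refine Finset.sum_le_sum fun i _ => Finset.sum_le_sum fun j _ => ?_
          have w0 : ∀ i, 0 ≤ weights A t S i := fun i => by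
            dsimp only [weights]; split_ifs <;> positivity
          have w1 : ∀ i, weights A t S i ≤ 1 := fun i => by
            dsimp only [weights]; split_ifs
            · exact hinv i
            · norm_num
          have hp : (pairPulls A t i j : ℝ) ≤ t := by
            exact_mod_cast (pairPulls_le_left A t i j).trans (pulls_le A t i)
          have hw : weights A t S i * weights A t S j ≤ 1 :=
            mul_le_one₀ (w1 i) (w0 j) (w1 j)
          have hw0 : 0 ≤ weights A t S i * weights A t S j := mul_nonneg (w0 i) (w0 j)
          refine mul_le_mul ?_ hp (by positivity) hR0
          have := hR i j
          nlinarith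
      _ = _ := by simp; ring
  unfold confWidth
  have h3 : lam * (∑ i ∈ S, Γ i i / (pulls A t i : ℝ)) ≤ lam * ((d : ℝ) ^ 2 * R * t) := by
    refine mul_le_mul_of_nonneg_left (h1.trans ?_) hlam.le
    have : (d : ℝ) * R ≤ d * R * (d * t) := by
      have : (1 : ℝ) ≤ d * t := by nlinarith
      have : 0 ≤ d * R := by positivity
      nlinarith
    nlinarith
  nlinarith

/-- The stage `t` is large with respect to the matrix `Γ`, whose coefficients are at most `R` and
whose positive diagonal coefficients are at least `1 / R`. -/
structure IsLarge (Γ : Matrix (Fin d) (Fin d) ℝ) (lam R : ℝ) (t : ℕ) : Prop where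
  three_le : 3 ≤ t
  one_le : 1 ≤ R
  le_bound : ∀ i j, Γ i j ≤ R
  bound_le : ∀ i, 0 < Γ i i → 1 / R ≤ Γ i i
  bound_le_stage : 2 * R ≤ t
  bound_le_lam : 2 * R ≤ lam * t
  width_le_stage : (lam + 1) * (d : ℝ) ^ 2 * R ≤ t

lemma one_le_log {t : ℕ} (ht : 3 ≤ t) : 1 ≤ Real.log t := by
  have ht' : (3 : ℝ) ≤ t := by exact_mod_cast ht
  rw [Real.le_log_iff_exp_le (by linarith)]
  linarith [Real.exp_one_lt_d9]

/-- On the event that all exponents indexed by the net are small, the deviations of the estimated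
rewards of all actions are controlled. -/
lemma abs_dev_le {Γ : Matrix (Fin d) (Fin d) ℝ} (hd : 1 ≤ d) (hΓ : ∀ i j, 0 ≤ Γ i j)
    {lam R : ℝ} (hlam : 0 < lam) {m t : ℕ} (hm : 1 ≤ m) (ht : IsLarge Γ lam R t)
    (A : ℕ → Finset (Fin d)) (M : Fin d → ℝ) (hn : ∀ i, 1 ≤ pulls A t i)
    (hgood : ∀ u ∈ net d (mesh m lam) (gridSize (mesh m lam) t),
      |∑ i, u i * M i| ≤ 1 / 2 * quadForm Γ A t u + level t)
    (hzero : ∀ i, Γ i i = 0 → M i = 0)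
    (S : Finset (Fin d)) (hS : S.card = m) :
    |∑ i ∈ S, 1 / (pulls A t i : ℝ) * M i|
      ≤ √(2 * Real.log t) * √(confWidth Γ lam A t S) := by
  obtain ⟨ht3, hR1, hR, hRl, hRt, hRlam, hwt⟩ := ht
  have ht3' : (3 : ℝ) ≤ t := by exact_mod_cast ht3
  have hl1 := one_le_log ht3
  have hlt : Real.log t ≤ t := by have := Real.log_le_sub_one_of_pos (show (0:ℝ) < t by linarith); linarith
  have hε := mesh_pos hm hlam
  set ε := mesh m lam with hεdef
  have hδ : 0 < level t := by unfold level; linarith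
  have hn' : ∀ i, (1 : ℝ) ≤ pulls A t i := fun i => by exact_mod_cast hn i
  have hnt : ∀ i, (pulls A t i : ℝ) ≤ t := fun i => by exact_mod_cast pulls_le A t i
  have hR0 : 0 < R := by linarith
  have hcoord : ∀ i, |M i| ≤ 4 * √(level t) * √(Γ i i * pulls A t i) := by
    intro i
    rcases (hΓ i i).eq_or_lt with h0 | h0
    · rw [hzero i h0.symm]; simp; positivity
    · refine abs_coord_le hε (min_le_left _ _) hδ hgood i h0 (hn i)
        ((abs_log_le_of_sq (t := (t : ℝ)) (by linarith) ?_ ?_ ?_).trans (le_gridSize hε t))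
      · have := hn' i; positivity
      · have h1 : (1 / R) ≤ Γ i i * pulls A t i := by
          have := hRl i h0; have := hn' i; nlinarith
        have h2 : 1 ≤ (Γ i i * pulls A t i) * R := by
          rwa [div_le_iff₀ hR0] at h1
        have h3 : 0 < Γ i i * pulls A t i := by have := hn' i; positivity
        rw [Real.sq_sqrt (by positivity), div_le_iff₀ h3]
        unfold level
        have h4 : (1 : ℝ) ≤ (Γ i i * pulls A t i) * t := by nlinarith
        calc 2 * (3 / 4 * Real.log t) ≤ 2 * t * 1 := by linarith
          _ ≤ t ^ 2 * ((Γ i i * pulls A t i) * t) := by gcongr; nlinarith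
          _ = t ^ 3 * (Γ i i * pulls A t i) := by ring
          _ ≤ _ := by gcongr <;> linarith
      · have h3 : 0 < Γ i i * pulls A t i := by have := hn' i; positivity
        have h4 : Γ i i * pulls A t i ≤ t ^ 2 := by
          calc _ ≤ R * t := mul_le_mul (hR i i) (hnt i) (by linarith [hn' i]) hR0.le
            _ ≤ _ := by nlinarith
        rw [Real.sq_sqrt (by positivity), div_mul_eq_mul_div, le_div_iff₀ h3]
        unfold level
        calc 1 * (Γ i i * pulls A t i) ≤ t ^ 2 := by linarith
          _ ≤ t ^ 6 := by gcongr <;> linarith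
          _ ≤ _ := by
            have : (0 : ℝ) < t ^ 6 := by positivity
            nlinarith
  by_cases hpos : ∃ i ∈ S, 0 < Γ i i
  swap
  · push Not at hpos
    rw [Finset.sum_eq_zero]
    · simp; positivity
    · intro i hi
      rw [hzero i (le_antisymm (hpos i hi) (hΓ i i)), mul_zero]
  obtain ⟨i₀, hi₀, hΓ₀⟩ := hpos
  -- A single arm of positive variance proxy already gives, through the regularization, a polynomial
  -- lower bound; with the upper bound, all rounded numbers lie between `t⁻³` and `t³`.
  have hQlow : lam / (R * t) ≤ confWidth Γ lam A t S := by
    unfold confWidth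
    have h1 := quadForm_nonneg hΓ A t (u := weights A t S)
      (fun i => by dsimp only [weights]; split_ifs <;> positivity)
    have h2 : Γ i₀ i₀ / (pulls A t i₀ : ℝ) ≤ ∑ i ∈ S, Γ i i / (pulls A t i : ℝ) :=
      Finset.single_le_sum (f := fun i => Γ i i / (pulls A t i : ℝ))
        (fun i _ => div_nonneg (hΓ i i) (by linarith [hn' i])) hi₀
    have h3 : 1 / R / t ≤ Γ i₀ i₀ / (pulls A t i₀ : ℝ) :=
      div_le_div₀ hΓ₀.le (hRl i₀ hΓ₀) (by linarith [hn' i₀]) (hnt i₀)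
    have e : lam / (R * t) = lam * (1 / R / t) := by field_simp
    rw [e]
    nlinarith
  have hQ : 0 < confWidth Γ lam A t S := lt_of_lt_of_le (by positivity) hQlow
  have hQup := confWidth_le hR hR0.le hd hlam A (show 1 ≤ t by omega) hn S
  refine (abs_weighted_noise_le hΓ hε hδ hlam hgood hn hcoord S hQ fun i =>
    (abs_log_le_of_sq (t := (t : ℝ)) (by linarith) ?_ ?_ ?_).trans (le_gridSize hε t)).trans ?_
  · have := hn' i; positivity
  · rw [mul_pow, Real.sq_sqrt (by positivity)]
    have h1 : (1 / (pulls A t i : ℝ)) ^ 2 ≤ 1 := by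
      apply pow_le_one₀ (by positivity)
      rw [div_le_one (by linarith [hn' i])]; exact hn' i
    have h2 : 2 * level t / confWidth Γ lam A t S ≤ t ^ 6 := by
      rw [div_le_iff₀ hQ]
      have h3 : 1 ≤ t ^ 2 * confWidth Γ lam A t S := by
        rw [div_le_iff₀ (by positivity)] at hQlow
        have h5 : confWidth Γ lam A t S * (R * t) * 2 ≤ confWidth Γ lam A t S * t * (lam * t) := by
          calc _ = confWidth Γ lam A t S * t * (2 * R) := by ring
            _ ≤ _ := by gcongr
        have h6 : lam * 1 ≤ lam * (t ^ 2 * confWidth Γ lam A t S) := by nlinarith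
        exact le_of_mul_le_mul_left h6 hlam
      unfold level
      calc 2 * (3 / 4 * Real.log t) ≤ 2 * t * 1 := by linarith
        _ ≤ t ^ 2 * (t ^ 2 * confWidth Γ lam A t S) := by gcongr; nlinarith
        _ = t ^ 4 * confWidth Γ lam A t S := by ring
        _ ≤ _ := by gcongr <;> linarith
    calc _ ≤ (t : ℝ) ^ 6 * 1 := by gcongr
      _ = _ := by ring
  · rw [mul_pow, Real.sq_sqrt (by positivity), div_pow, one_pow]
    have hp := hn' i
    have e : 2 * level t / confWidth Γ lam A t S * (1 / (pulls A t i : ℝ) ^ 2) * (t : ℝ) ^ 6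
        = 2 * level t * t ^ 6 / (confWidth Γ lam A t S * (pulls A t i : ℝ) ^ 2) := by
      field_simp
    rw [e, le_div_iff₀ (by positivity)]
    unfold level
    calc 1 * (confWidth Γ lam A t S * (pulls A t i : ℝ) ^ 2) ≤ ((t : ℝ) * t) * t ^ 2 := by
          rw [one_mul]
          have := hnt i
          gcongr
          refine hQup.trans ?_
          gcongr
      _ = (t : ℝ) ^ 4 := by ring
      _ ≤ (t : ℝ) ^ 6 := by gcongr <;> linarith
      _ ≤ _ := by
        have : (0 : ℝ) < (t : ℝ) ^ 6 := by positivity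
        nlinarith
  · have hml : 4 * ε * √(S.card / lam) ≤ 1 / 5 := by
      have h1 : ε ≤ √(lam / m) / 20 := min_le_right _ _
      have hm' : (0 : ℝ) < m := by positivity
      have h2 : √(lam / m) * √(m / lam) = 1 := by
        rw [← Real.sqrt_mul (by positivity)]
        have : lam / m * (m / lam) = 1 := by field_simp
        rw [this, Real.sqrt_one]
      rw [hS]
      calc _ ≤ 4 * (√(lam / m) / 20) * √(m / lam) := by gcongr
        _ = (√(lam / m) * √(m / lam)) / 5 := by ring
        _ = _ := by rw [h2]
    -- The mesh makes the rounding term at most `1/5`, and `(3/4) · 1.6143² < 2`: the level leaves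
    -- exactly this room below `2 log t`.
    have h2 : √2 ≤ 1.4143 := by rw [Real.sqrt_le_left] <;> norm_num
    have h3 : √(level t) * (√2 + 4 * ε * √(S.card / lam)) ≤ √(2 * Real.log t) := by
      apply Real.le_sqrt_of_sq_le
      rw [mul_pow, Real.sq_sqrt hδ.le]
      have h4 : (√2 + 4 * ε * √(S.card / lam)) ^ 2 ≤ 1.6143 ^ 2 := by
        gcongr
        linarith
      unfold level
      nlinarith
    calc _ = √(level t) * (√2 + 4 * ε * √(S.card / lam)) * √(confWidth Γ lam A t S) := by ring
      _ ≤ _ := by gcongr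

/-! ### Correlation coefficients and the width of the played action. -/

section corr
variable {Γ : Matrix (Fin d) (Fin d) ℝ}

/-- Positivity of the form on the plane of two basis vectors; a vanishing `Γ j j` needs its own test
vector. -/
lemma sq_le_diag_mul_diag (hP : Γ.PosSemidef) (hΓ : ∀ i j, 0 ≤ Γ i j) (i j : Fin d) :
    Γ i j ^ 2 ≤ Γ i i * Γ j j := by
  have hsym : Γ j i = Γ i j := by
    have := hP.1.apply i j
    simpa using this
  have key : ∀ x y : ℝ, 0 ≤ x ^ 2 * Γ i i + 2 * x * y * Γ i j + y ^ 2 * Γ j j := by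
    intro x y
    have h := hP.dotProduct_mulVec_nonneg (Pi.single i x + Pi.single j y)
    simp only [star_trivial, Matrix.mulVec_add, dotProduct_add, add_dotProduct,
      Matrix.mulVec_single, single_dotProduct] at h
    simp [hsym] at h
    nlinarith
  by_contra! hlt
  have h1 := hΓ i i
  have h2 := hΓ j j
  rcases h2.eq_or_lt with h0 | h0
  · rw [← h0] at hlt key
    have hp : 0 < Γ i j := by
      rcases (hΓ i j).eq_or_lt with h | h
      · rw [← h] at hlt; simp at hlt
      · exact h
    have := key 1 (-(Γ i i + 1) / Γ i j)
    field_simp at this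
    nlinarith
  · have := key (Γ j j) (-Γ i j)
    nlinarith

lemma corr_bdd (hP : Γ.PosSemidef) (hΓ : ∀ i j, 0 ≤ Γ i j) (S : Finset (Fin d)) :
    ∀ r ∈ {r : ℝ | ∃ i ∈ S, ∃ j ∈ S, i ≠ j ∧ r = Γ i j / Real.sqrt (Γ i i * Γ j j)},
      0 ≤ r ∧ r ≤ 1 := by
  rintro r ⟨i, _, j, _, _, rfl⟩
  refine ⟨div_nonneg (hΓ i j) (Real.sqrt_nonneg _), ?_⟩
  apply div_le_one_of_le₀ _ (Real.sqrt_nonneg _)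
  exact Real.le_sqrt_of_sq_le (sq_le_diag_mul_diag hP hΓ i j)

lemma corr_mem (hP : Γ.PosSemidef) (hΓ : ∀ i j, 0 ≤ Γ i j) (S : Finset (Fin d)) :
    0 ≤ corr Γ S ∧ corr Γ S ≤ 1 :=
  ⟨Real.sSup_nonneg fun r hr => (corr_bdd hP hΓ S r hr).1,
    Real.sSup_le (fun r hr => (corr_bdd hP hΓ S r hr).2) zero_le_one⟩

lemma maxCorr_mem (hP : Γ.PosSemidef) (hΓ : ∀ i j, 0 ≤ Γ i j) (A : ℕ → Finset (Fin d)) (T : ℕ) :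
    0 ≤ maxCorr Γ A T ∧ maxCorr Γ A T ≤ 1 := by
  refine ⟨Real.sSup_nonneg ?_, Real.sSup_le ?_ zero_le_one⟩
  · rintro r ⟨t, _, rfl⟩; exact (corr_mem hP hΓ _).1
  · rintro r ⟨t, _, rfl⟩; exact (corr_mem hP hΓ _).2

lemma le_maxCorr_mul (hP : Γ.PosSemidef) (hΓ : ∀ i j, 0 ≤ Γ i j) {G : ℝ} (hG : ∀ i, Γ i i ≤ G)
    (A : ℕ → Finset (Fin d)) {t T : ℕ} (ht : t ∈ Finset.Icc 1 T) {i j : Fin d}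
    (hi : i ∈ A t) (hj : j ∈ A t) (hij : i ≠ j) :
    Γ i j ≤ maxCorr Γ A T * G := by
  have hG0 : 0 ≤ G := (hΓ i i).trans (hG i)
  have h1 : Γ i j / √(Γ i i * Γ j j) ≤ maxCorr Γ A T := by
    refine le_trans (le_csSup ⟨1, fun r hr => (corr_bdd hP hΓ _ r hr).2⟩
      ⟨i, hi, j, hj, hij, rfl⟩) (le_csSup ⟨1, ?_⟩ ⟨t, ht, rfl⟩)
    rintro r ⟨t, _, rfl⟩
    exact (corr_mem hP hΓ _).2
  have h2 := sq_le_diag_mul_diag hP hΓ i j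
  have hm := (maxCorr_mem hP hΓ A T).1
  -- If the denominator vanishes, the coefficient is `0` by convention and gives no information, but
  -- then `Γ i j = 0` by the minor inequality.
  rcases (mul_nonneg (hΓ i i) (hΓ j j)).eq_or_lt with h | h
  · rw [← h] at h2
    have : Γ i j = 0 := by
      have : Γ i j ^ 2 = 0 := le_antisymm h2 (sq_nonneg _)
      simpa using this
    rw [this]; positivity
  · rw [div_le_iff₀ (Real.sqrt_pos.2 h)] at h1
    refine h1.trans ?_
    gcongr
    rw [Real.sqrt_le_left hG0, sq]
    exact mul_le_mul (hG i) (hG j) (hΓ j j) hG0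

/-- Off the diagonal, `Γ i j ≤ γ G` and joint pulls are at most the geometric mean of the two
counts. A share `γ` of the diagonal is added to complete the square; the share `1 - γ` remains. -/
lemma confWidth_le_corr (hP : Γ.PosSemidef) (hΓ : ∀ i j, 0 ≤ Γ i j) {G : ℝ} (hG : ∀ i, Γ i i ≤ G)
    {lam : ℝ} (hlam : 0 < lam)
    (A : ℕ → Finset (Fin d)) {t T : ℕ} (ht : t ∈ Finset.Icc 1 T) (hn : ∀ i, 1 ≤ pulls A t i) :
    confWidth Γ lam A t (A t)
      ≤ G * (lam + 1 - maxCorr Γ A T) * ∑ i ∈ A t, 1 / (pulls A t i : ℝ)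
        + G * maxCorr Γ A T * (∑ i ∈ A t, 1 / √(pulls A t i : ℝ)) ^ 2 := by
  have hm := maxCorr_mem hP hΓ A T
  set γ := maxCorr Γ A T with hγ
  have hn' : ∀ i, (1 : ℝ) ≤ pulls A t i := fun i => by exact_mod_cast hn i
  have h1 : ∑ i ∈ A t, Γ i i / (pulls A t i : ℝ) ≤ G * ∑ i ∈ A t, 1 / (pulls A t i : ℝ) := by
    rw [Finset.mul_sum]
    refine Finset.sum_le_sum fun i _ => ?_
    rw [mul_one_div]
    have := hG i
    gcongr
  have h2 : quadForm Γ A t (weights A t (A t))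
      ≤ G * (1 - γ) * ∑ i ∈ A t, 1 / (pulls A t i : ℝ)
        + G * γ * (∑ i ∈ A t, 1 / √(pulls A t i : ℝ)) ^ 2 := by
    have e : quadForm Γ A t (weights A t (A t)) = ∑ i ∈ A t, ∑ j ∈ A t,
        1 / (pulls A t i : ℝ) * (1 / (pulls A t j : ℝ)) * Γ i j * pairPulls A t i j := by
      have e1 : ∀ i j, weights A t (A t) i * weights A t (A t) j * Γ i j * pairPulls A t i j
          = if i ∈ A t then (if j ∈ A t then
            1 / (pulls A t i : ℝ) * (1 / (pulls A t j : ℝ)) * Γ i j * pairPulls A t i j else 0)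
            else 0 := by
        intro i j
        by_cases hi : i ∈ A t <;> by_cases hj : j ∈ A t <;> simp [weights, hi, hj]
      rw [quadForm_eq]
      simp_rw [e1]
      rw [← Finset.sum_filter_add_sum_filter_not Finset.univ (fun i => i ∈ A t)]
      rw [Finset.sum_eq_zero (s := Finset.univ.filter (fun i => ¬ i ∈ A t)), add_zero]
      · refine Finset.sum_congr (by simp) fun i hi => ?_
        have hi : i ∈ A t := by simpa using hi
        simp only [hi, if_true, Finset.sum_ite_mem, Finset.univ_inter]
      · intro i hi
        have hi : ¬ i ∈ A t := by simpa using hi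
        simp [hi]
    rw [e, sq, Finset.sum_mul_sum, Finset.mul_sum, Finset.mul_sum, ← Finset.sum_add_distrib]
    refine Finset.sum_le_sum fun i hi => ?_
    have hterm : ∀ j ∈ A t,
        1 / (pulls A t i : ℝ) * (1 / (pulls A t j : ℝ)) * Γ i j * pairPulls A t i j
        ≤ (if i = j then G * (1 - γ) * (1 / (pulls A t i : ℝ)) else 0)
          + G * γ * (1 / √(pulls A t i : ℝ) * (1 / √(pulls A t j : ℝ))) := by
      intro j hj
      have hpi := hn' i
      have hpj := hn' j
      split_ifs with hij
      · subst hij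
        rw [pairPulls_self]
        have e1 : 1 / (pulls A t i : ℝ) * (1 / (pulls A t i : ℝ)) * Γ i i * pulls A t i
            = Γ i i * (1 / (pulls A t i : ℝ)) := by field_simp
        have e2 : 1 / √(pulls A t i : ℝ) * (1 / √(pulls A t i : ℝ)) = 1 / (pulls A t i : ℝ) := by
          rw [div_mul_div_comm, Real.mul_self_sqrt (by linarith), one_mul]
        rw [e1, e2]
        have : 0 ≤ 1 / (pulls A t i : ℝ) := by positivity
        have := hG i
        nlinarith
      · rw [zero_add]
        have hle := le_maxCorr_mul hP hΓ hG A ht hi hj hij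
        have hpp : (pairPulls A t i j : ℝ) ≤ √(pulls A t i : ℝ) * √(pulls A t j : ℝ) := by
          rw [← Real.sqrt_mul (by positivity)]
          apply Real.le_sqrt_of_sq_le
          rw [sq]
          have a1 : (pairPulls A t i j : ℝ) ≤ pulls A t i := by
            exact_mod_cast pairPulls_le_left A t i j
          have a2 : (pairPulls A t i j : ℝ) ≤ pulls A t j := by
            exact_mod_cast pairPulls_le_right A t i j
          gcongr
        have hg0 := hΓ i j
        have hgG : 0 ≤ γ * G := hg0.trans hle
        calc _ ≤ 1 / (pulls A t i : ℝ) * (1 / (pulls A t j : ℝ)) * (γ * G)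
              * (√(pulls A t i : ℝ) * √(pulls A t j : ℝ)) := by gcongr
          _ = (γ * G) * ((√(pulls A t i : ℝ) / (pulls A t i : ℝ))
              * (√(pulls A t j : ℝ) / (pulls A t j : ℝ))) := by ring
          _ = _ := by rw [Real.sqrt_div_self', Real.sqrt_div_self']; ring
    refine (Finset.sum_le_sum hterm).trans (le_of_eq ?_)
    rw [Finset.sum_add_distrib, ← Finset.mul_sum, Finset.sum_ite_eq, if_pos hi]
  unfold confWidth
  nlinarith

end corr

/-! ### The exponential supermartingale and the bad events. -/

section Probability

variable {Ω : Type*}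

lemma measurable_mask [MeasurableSpace Ω] {A : Ω → Finset (Fin d)}
    (hA : ∀ S, MeasurableSet {ω | A ω = S}) (u : Fin d → ℝ) (i : Fin d) :
    Measurable fun ω => mask u (A ω) i := by
  have h : MeasurableSet {ω | i ∈ A ω} := by
    have : {ω | i ∈ A ω} = ⋃ S ∈ {S : Finset (Fin d) | i ∈ S}, {ω | A ω = S} := by
      ext ω; simp
    rw [this]
    exact MeasurableSet.biUnion (Set.to_countable _) fun S _ => hA S
  exact Measurable.ite h measurable_const measurable_const

lemma measurable_expStat [MeasurableSpace Ω] (Γ : Matrix (Fin d) (Fin d) ℝ) (μ u : Fin d → ℝ)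
    {A : ℕ → Ω → Finset (Fin d)} {X : ℕ → Ω → Fin d → ℝ} (t : ℕ)
    (hA : ∀ s ∈ Finset.Ico 1 t, ∀ S, MeasurableSet {ω | A s ω = S})
    (hX : ∀ s ∈ Finset.Ico 1 t, Measurable (X s)) :
    Measurable fun ω => expStat Γ μ u (fun s => A s ω) (fun s => X s ω) t := by
  unfold expStat
  refine Finset.measurable_sum _ fun s hs => ?_
  have hm := fun i => measurable_mask (hA s hs) u i
  have hx : ∀ i, Measurable fun ω => X s ω i := fun i => (measurable_pi_apply i).comp (hX s hs)
  simp only [dotProduct, Matrix.mulVec, Pi.sub_apply]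
  fun_prop

variable [mΩ : MeasurableSpace Ω] {P : Measure Ω}
  {ℱ : Filtration ℕ mΩ} {C Γ : Matrix (Fin d) (Fin d) ℝ} {μ : Fin d → ℝ}
  {X : ℕ → Ω → Fin d → ℝ} {A : ℕ → Ω → Finset (Fin d)}

lemma measurable_expStat_filtration (hX : ∀ t, 1 ≤ t → Measurable[ℱ t] (X t))
    (hA : ∀ t S, MeasurableSet[ℱ t] {ω | A (t + 1) ω = S}) (u : Fin d → ℝ) (n : ℕ) :
    Measurable[ℱ n] fun ω => expStat Γ μ u (fun s => A s ω) (fun s => X s ω) (n + 1) := by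
  refine @measurable_expStat d Ω (ℱ n) Γ μ u A X (n + 1) ?_ ?_
  · intro s hs S
    rw [Finset.mem_Ico] at hs
    obtain ⟨k, rfl⟩ : ∃ k, s = k + 1 := ⟨s - 1, by omega⟩
    exact ℱ.mono (by omega) _ (hA k S)
  · intro s hs
    rw [Finset.mem_Ico] at hs
    exact (hX s hs.1).mono (ℱ.mono (by omega)) le_rfl

/-- The subgaussian bound is stated for `X 1` and moves to `X t` by equality of laws; compensating
with `Γ` instead of `C` only decreases the exponent. -/
lemma lintegral_exp_increment_le (hE : IsEnvironment P ℱ C μ X) {v : Fin d → ℝ}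
    (hv : v ⬝ᵥ C.mulVec v ≤ v ⬝ᵥ Γ.mulVec v) {t : ℕ} (ht : 1 ≤ t) :
    ∫⁻ ω, ENNReal.ofReal (Real.exp (v ⬝ᵥ (X t ω - μ) - 1 / 2 * (v ⬝ᵥ Γ.mulVec v))) ∂P ≤ 1 := by
  have hφ : Measurable fun x : Fin d → ℝ =>
      ENNReal.ofReal (Real.exp (v ⬝ᵥ (x - μ) - 1 / 2 * (v ⬝ᵥ Γ.mulVec v))) := by
    simp only [dotProduct, Pi.sub_apply]
    fun_prop
  have h1 := ((hE.identDistrib t ht).comp hφ).lintegral_eq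
  simp only [Function.comp_def] at h1
  rw [h1]
  have hint := hE.integrable_exp v
  have e : ∀ ω, Real.exp (v ⬝ᵥ (X 1 ω - μ) - 1 / 2 * (v ⬝ᵥ Γ.mulVec v))
      = Real.exp (v ⬝ᵥ (X 1 ω - μ)) * Real.exp (-(1 / 2 * (v ⬝ᵥ Γ.mulVec v))) := fun ω => by
    rw [← Real.exp_add, sub_eq_add_neg]
  simp_rw [e]
  rw [← ofReal_integral_eq_lintegral_ofReal (hint.mul_const _)
    (Filter.Eventually.of_forall fun ω => by positivity), integral_mul_const,
    ENNReal.ofReal_le_one]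
  calc _ ≤ Real.exp (1 / 2 * (v ⬝ᵥ Γ.mulVec v)) * Real.exp (-(1 / 2 * (v ⬝ᵥ Γ.mulVec v))) := by
        gcongr
        refine (hE.subgaussian v).trans ?_
        gcongr
    _ = 1 := by rw [← Real.exp_add]; simp

/-- The exponential supermartingale has expectation at most one. -/
lemma lintegral_exp_expStat_le [IsProbabilityMeasure P]
    (hE : IsEnvironment P ℱ C μ X)
    (hA : ∀ t S, MeasurableSet[ℱ t] {ω | A (t + 1) ω = S}) {u : Fin d → ℝ}
    (hu : ∀ S, mask u S ⬝ᵥ C.mulVec (mask u S) ≤ mask u S ⬝ᵥ Γ.mulVec (mask u S)) (n : ℕ) :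
    ∫⁻ ω, ENNReal.ofReal (Real.exp
      (expStat Γ μ u (fun s => A s ω) (fun s => X s ω) (n + 1))) ∂P ≤ 1 := by
  induction n with
  | zero => simp [expStat]
  | succ n ih =>
    let Z : Ω → ENNReal := fun ω => ENNReal.ofReal (Real.exp
      (expStat Γ μ u (fun s => A s ω) (fun s => X s ω) (n + 1)))
    let Y : Finset (Fin d) → Ω → ENNReal := fun S ω => ENNReal.ofReal (Real.exp
      (mask u S ⬝ᵥ (X (n + 1) ω - μ) - 1 / 2 * (mask u S ⬝ᵥ Γ.mulVec (mask u S))))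
    have hZ : Measurable[ℱ n] Z := by
      have := measurable_expStat_filtration (Γ := Γ) (μ := μ) hE.measurable hA u n
      exact ENNReal.measurable_ofReal.comp (Real.measurable_exp.comp this)
    have hY : ∀ S, Measurable[MeasurableSpace.comap (X (n + 1)) inferInstance] (Y S) := by
      intro S
      have hφ : Measurable fun x : Fin d → ℝ => ENNReal.ofReal (Real.exp
          (mask u S ⬝ᵥ (x - μ) - 1 / 2 * (mask u S ⬝ᵥ Γ.mulVec (mask u S)))) := by
        simp only [dotProduct, Pi.sub_apply]
        fun_prop
      exact hφ.comp (comap_measurable _)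
    have hXm : Measurable (X (n + 1)) := (hE.measurable (n + 1) (by omega)).mono (ℱ.le _) le_rfl
    have hcomap : MeasurableSpace.comap (X (n + 1)) inferInstance ≤ mΩ := hXm.comap_le
    -- Freezing the value of the predictable action makes the new factor a function of `X (n + 1)`
    -- alone, hence independent of the past factor.
    have hsplit : ∀ ω, ENNReal.ofReal (Real.exp
        (expStat Γ μ u (fun s => A s ω) (fun s => X s ω) (n + 1 + 1)))
        = ∑ S, ({ω | A (n + 1) ω = S}.indicator Z ω) * Y S ω := by
      intro ω
      rw [Finset.sum_eq_single (A (n + 1) ω)]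
      · rw [Set.indicator_of_mem (by simp), ← ENNReal.ofReal_mul (by positivity), ← Real.exp_add]
        congr 2
        unfold expStat
        rw [Finset.sum_Ico_succ_top (by omega)]
      · intro S _ hS
        rw [Set.indicator_of_notMem (by simpa using fun h => hS h.symm), zero_mul]
      · simp
    have hZS : ∀ S, Measurable[ℱ n] ({ω | A (n + 1) ω = S}.indicator Z) := fun S =>
      hZ.indicator (hA n S)
    simp_rw [hsplit]
    rw [lintegral_finsetSum]
    · calc _ = ∑ S, (∫⁻ ω, {ω | A (n + 1) ω = S}.indicator Z ω ∂P) * ∫⁻ ω, Y S ω ∂P := by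
            refine Finset.sum_congr rfl fun S _ => ?_
            exact lintegral_mul_eq_lintegral_mul_lintegral_of_independent_measurableSpace
              (ℱ.le n) hcomap (hE.indep n).symm (hZS S) (hY S)
        _ ≤ ∑ S, (∫⁻ ω, {ω | A (n + 1) ω = S}.indicator Z ω ∂P) * 1 := by
            refine Finset.sum_le_sum fun S _ => ?_
            have : ∫⁻ ω, Y S ω ∂P ≤ 1 := lintegral_exp_increment_le hE (hu S) (by omega)
            gcongr
        _ = ∫⁻ ω, Z ω ∂P := by
            simp_rw [mul_one]
            rw [← lintegral_finsetSum]
            · refine lintegral_congr fun ω => ?_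
              rw [Finset.sum_eq_single (A (n + 1) ω)]
              · rw [Set.indicator_of_mem (by simp)]
              · intro S _ hS
                rw [Set.indicator_of_notMem (by simpa using fun h => hS h.symm)]
              · simp
            · exact fun S _ => (hZS S).mono (ℱ.le n) le_rfl
        _ ≤ 1 := ih
    · exact fun S _ => ((hZS S).mono (ℱ.le n) le_rfl).mul ((hY S).mono hcomap le_rfl)

lemma measure_expStat_ge_le [IsProbabilityMeasure P]
    (hE : IsEnvironment P ℱ C μ X)
    (hA : ∀ t S, MeasurableSet[ℱ t] {ω | A (t + 1) ω = S}) {u : Fin d → ℝ}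
    (hu : ∀ S, mask u S ⬝ᵥ C.mulVec (mask u S) ≤ mask u S ⬝ᵥ Γ.mulVec (mask u S)) {t : ℕ}
    (ht : 1 ≤ t) (δ : ℝ) :
    P {ω | δ ≤ expStat Γ μ u (fun s => A s ω) (fun s => X s ω) t}
      ≤ ENNReal.ofReal (Real.exp (-δ)) := by
  obtain ⟨n, rfl⟩ : ∃ n, t = n + 1 := ⟨t - 1, by omega⟩
  have hm : Measurable fun ω => ENNReal.ofReal (Real.exp
      (expStat Γ μ u (fun s => A s ω) (fun s => X s ω) (n + 1))) :=
    ENNReal.measurable_ofReal.comp (Real.measurable_exp.comp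
      ((measurable_expStat_filtration hE.measurable hA u n).mono (ℱ.le n) le_rfl))
  have h := meas_ge_le_lintegral_div (μ := P) hm.aemeasurable
    (ε := ENNReal.ofReal (Real.exp δ)) (by simp [Real.exp_pos]) ENNReal.ofReal_ne_top
  have e : {ω | δ ≤ expStat Γ μ u (fun s => A s ω) (fun s => X s ω) (n + 1)}
      = {ω | ENNReal.ofReal (Real.exp δ) ≤ ENNReal.ofReal (Real.exp
        (expStat Γ μ u (fun s => A s ω) (fun s => X s ω) (n + 1)))} := by
    ext ω
    simp [ENNReal.ofReal_le_ofReal_iff (Real.exp_pos _).le]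
  rw [e]
  refine h.trans ((ENNReal.div_le_div_right (lintegral_exp_expStat_le hE hA hu n) _).trans ?_)
  rw [one_div, ← ENNReal.ofReal_inv_of_pos (Real.exp_pos _), ← Real.exp_neg]

/-- The event that some exponent indexed by the net is large at stage `t`. -/
def badEvent (Γ : Matrix (Fin d) (Fin d) ℝ) (μ : Fin d → ℝ) (A : ℕ → Ω → Finset (Fin d))
    (X : ℕ → Ω → Fin d → ℝ) (ε : ℝ) (t : ℕ) : Set Ω :=
  ⋃ u ∈ net d ε (gridSize ε t),
    ({ω | level t ≤ expStat Γ μ u (fun s => A s ω) (fun s => X s ω) t} ∪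
      {ω | level t ≤ expStat Γ μ (-u) (fun s => A s ω) (fun s => X s ω) t})

lemma measurableSet_badEvent (hE : IsEnvironment P ℱ C μ X)
    (hA : ∀ t S, MeasurableSet[ℱ t] {ω | A (t + 1) ω = S}) (ε : ℝ) {t : ℕ} (ht : 1 ≤ t) :
    MeasurableSet (badEvent Γ μ A X ε t) := by
  obtain ⟨n, rfl⟩ : ∃ n, t = n + 1 := ⟨t - 1, by omega⟩
  have h : ∀ u, Measurable fun ω => expStat Γ μ u (fun s => A s ω) (fun s => X s ω) (n + 1) :=
    fun u => (measurable_expStat_filtration hE.measurable hA u n).mono (ℱ.le n) le_rfl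
  exact Finset.measurableSet_biUnion _ fun u _ =>
    (measurableSet_le measurable_const (h u)).union (measurableSet_le measurable_const (h (-u)))

lemma mask_neg (u : Fin d → ℝ) (S : Finset (Fin d)) : mask (-u) S = -mask u S := by
  ext i
  by_cases hi : i ∈ S <;> simp [mask, hi]

lemma measure_badEvent_le [IsProbabilityMeasure P]
    (hE : IsEnvironment P ℱ C μ X) (hC : PosLE C Γ)
    (hA : ∀ t S, MeasurableSet[ℱ t] {ω | A (t + 1) ω = S}) (ε : ℝ) {t : ℕ} (ht : 1 ≤ t) :
    P.real (badEvent Γ μ A X ε t)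
      ≤ (2 * gridSize ε t + 2) ^ d * (2 * Real.exp (-level t)) := by
  have h : P (badEvent Γ μ A X ε t)
      ≤ ENNReal.ofReal ((2 * gridSize ε t + 2) ^ d * (2 * Real.exp (-level t))) := by
    refine (measure_biUnion_finset_le _ _).trans ?_
    have hterm : ∀ u ∈ net d ε (gridSize ε t),
        P ({ω | level t ≤ expStat Γ μ u (fun s => A s ω) (fun s => X s ω) t} ∪
          {ω | level t ≤ expStat Γ μ (-u) (fun s => A s ω) (fun s => X s ω) t})
        ≤ ENNReal.ofReal (2 * Real.exp (-level t)) := by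
      intro u hu
      have hu1 : ∀ S, mask u S ⬝ᵥ C.mulVec (mask u S) ≤ mask u S ⬝ᵥ Γ.mulVec (mask u S) := by
        intro S
        refine hC _ fun i => ?_
        unfold mask
        split_ifs
        · exact net_nonneg hu i
        · exact le_rfl
      refine (measure_union_le _ _).trans ?_
      rw [two_mul, ENNReal.ofReal_add (by positivity) (by positivity)]
      refine add_le_add (measure_expStat_ge_le hE hA hu1 ht _)
        (measure_expStat_ge_le hE hA (fun S => ?_) ht _)
      -- The domination of `C` by `Γ` is known for non-negative vectors only, but quadratic forms
      -- are even, so it passes to `-u`.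
      rw [mask_neg]
      simpa [Matrix.mulVec_neg] using hu1 S
    refine (Finset.sum_le_sum hterm).trans ?_
    rw [Finset.sum_const, nsmul_eq_mul,
      ENNReal.ofReal_mul (p := (2 * (gridSize ε t : ℝ) + 2) ^ d) (by positivity)]
    refine mul_le_mul' ?_ le_rfl
    rw [← ENNReal.ofReal_natCast]
    apply ENNReal.ofReal_le_ofReal
    exact_mod_cast net_card_le d ε (gridSize ε t)
  exact ENNReal.toReal_le_of_le_ofReal (by positivity) h

/-- The rewards of an arm with variance proxy zero are almost surely constant. -/
lemma ae_eq_mean_of_diag_eq_zero [IsProbabilityMeasure P]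
    (hE : IsEnvironment P ℱ C μ X) (hC : PosLE C Γ) {i : Fin d}
    (hi : Γ i i = 0) {t : ℕ} (ht : 1 ≤ t) : ∀ᵐ ω ∂P, X t ω i = μ i := by
  have h1 : ∀ᵐ ω ∂P, X 1 ω i = μ i := by
    have e : ∀ ω, (Pi.single i 1 : Fin d → ℝ) ⬝ᵥ (X 1 ω - μ) = X 1 ω i - μ i := by
      intro ω; simp
    have hCi : (Pi.single i 1 : Fin d → ℝ) ⬝ᵥ C.mulVec (Pi.single i 1) ≤ 0 := by
      have := hC (Pi.single i 1) (fun j => by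
        by_cases h : j = i
        · subst h; simp
        · simp [h])
      refine this.trans (le_of_eq ?_)
      simp [hi]
    have hint := hE.integrable_exp (Pi.single i 1)
    have hsub := hE.subgaussian (Pi.single i 1)
    simp_rw [e] at hint hsub
    have hY : Integrable (fun ω => X 1 ω i - μ i) P := (hE.integrable i).sub (integrable_const _)
    have hYmean : ∫ ω, (X 1 ω i - μ i) ∂P = 0 := by
      rw [integral_sub (hE.integrable i) (integrable_const _), hE.mean]; simp
    have hle : ∫ ω, Real.exp (X 1 ω i - μ i) ∂P ≤ 1 :=
      hsub.trans (Real.exp_le_one_iff.2 (by linarith))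
    have hY1 : Integrable (fun ω => (X 1 ω i - μ i) + 1) P := hY.add (integrable_const _)
    have hD : Integrable (fun ω => Real.exp (X 1 ω i - μ i) - ((X 1 ω i - μ i) + 1)) P :=
      hint.sub hY1
    have hDnn : 0 ≤ fun ω => Real.exp (X 1 ω i - μ i) - ((X 1 ω i - μ i) + 1) := fun ω => by
      have := Real.add_one_le_exp (X 1 ω i - μ i)
      simp only [Pi.zero_apply]
      linarith
    have hDint : ∫ ω, (Real.exp (X 1 ω i - μ i) - ((X 1 ω i - μ i) + 1)) ∂P = 0 := by
      refine le_antisymm ?_ (integral_nonneg hDnn)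
      rw [integral_sub hint hY1,
        integral_add hY (integrable_const _), hYmean]
      simpa using hle
    have hae := (integral_eq_zero_iff_of_nonneg hDnn hD).1 hDint
    filter_upwards [hae] with ω hω
    by_contra hne
    have := Real.add_one_lt_exp (sub_ne_zero.2 hne)
    simp only [Pi.zero_apply] at hω
    linarith
  have hm : MeasurableSet {x : Fin d → ℝ | x i = μ i} :=
    measurableSet_eq_fun (measurable_pi_apply i) measurable_const
  exact (hE.identDistrib t ht).symm.ae_snd (p := fun x => x i = μ i) hm h1

/-- Bounded functionals of the first actions are integrable. -/
lemma integrable_of_actions [IsProbabilityMeasure P]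
    (hA : ∀ t S, MeasurableSet[ℱ t] {ω | A (t + 1) ω = S}) (T : ℕ)
    (Φ : (ℕ → Finset (Fin d)) → ℝ)
    (hΦ : ∀ A A' : ℕ → Finset (Fin d), (∀ t ∈ Finset.Icc 1 T, A t = A' t) → Φ A = Φ A') :
    Integrable (fun ω => Φ fun t => A t ω) P := by
  let _ : MeasurableSpace (Finset (Fin d)) := ⊤
  let Φ' : (Finset.Icc 1 T → Finset (Fin d)) → ℝ := fun p =>
    Φ fun t => if h : t ∈ Finset.Icc 1 T then p ⟨t, h⟩ else ∅
  have e : (fun ω => Φ fun t => A t ω) = fun ω => Φ' fun t => A t ω := by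
    funext ω
    refine hΦ _ _ fun t ht => ?_
    simp only [ht, dif_pos]
  have hm : Measurable fun ω => Φ' fun t => A t ω := by
    have h1 : Measurable fun ω => (fun t : Finset.Icc 1 T => A t ω) := by
      refine measurable_pi_lambda _ fun t => ?_
      obtain ⟨t, ht⟩ := t
      obtain ⟨n, rfl⟩ : ∃ n, t = n + 1 := ⟨t - 1, by simp at ht; omega⟩
      exact measurable_to_countable' fun S => ℱ.le n _ (hA n S)
    exact (measurable_of_finite Φ').comp h1
  rw [e]
  refine Integrable.of_bound hm.aestronglyMeasurable (∑ p, ‖Φ' p‖)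
    (Filter.Eventually.of_forall fun ω => ?_)
  exact Finset.single_le_sum (f := fun p => ‖Φ' p‖) (fun p _ => norm_nonneg _)
    (Finset.mem_univ (fun t : Finset.Icc 1 T => A t ω))

end Probability

/-! ### Summed widths, large-stage estimates and optimism. -/

lemma sqrt_add_sqrt_le {x y : ℝ} (hx : 0 ≤ x) (hy : 0 ≤ y) : √x + √y ≤ 2 * √(x + y) := by
  have h1 : √x ≤ √(x + y) := Real.sqrt_le_sqrt (by linarith)
  have h2 : √y ≤ √(x + y) := Real.sqrt_le_sqrt (by linarith)
  linarith

lemma one_le_ceilLog (m : ℕ) : (1 : ℝ) ≤ ceilLog m := by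
  exact_mod_cast le_max_left _ _

lemma sqrt_log_le_ceilLog {m : ℕ} (hm : 1 ≤ m) :
    √(3 * Real.log (1 + m)) + 5 ≤ 8 * ceilLog m := by
  have hm' : (1 : ℝ) ≤ m := by exact_mod_cast hm
  have hc := one_le_ceilLog m
  have h1 : Real.log m / 1.6 ≤ ceilLog m := by
    refine (Nat.le_ceil _).trans ?_
    exact_mod_cast le_max_right _ _
  rw [div_le_iff₀ (by norm_num)] at h1
  have h2 : Real.log (1 + m) ≤ 1 + Real.log m := by
    have : (1 : ℝ) + m ≤ Real.exp 1 * m := by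
      have := Real.add_one_le_exp (1 : ℝ)
      nlinarith
    refine (Real.log_le_log (by linarith) this).trans (le_of_eq ?_)
    rw [Real.log_mul (Real.exp_pos _).ne' (by linarith), Real.log_exp]
  have h3 : √(3 * Real.log (1 + m)) ≤ 3 * ceilLog m := by
    rw [Real.sqrt_le_left (by linarith)]
    nlinarith
  linarith

/-- The bound on the cumulated confidence widths of a sequence of actions. -/
def widthBound (Γ : Matrix (Fin d) (Fin d) ℝ) (lam : ℝ) (m : ℕ) (A : ℕ → Finset (Fin d)) (T : ℕ) :
    ℝ :=
  5 * (lam + 1 - maxCorr Γ A T) * (ceilLog m : ℝ) ^ 2 + 45 * maxCorr Γ A T * m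

lemma sum_sqrt_confWidth_le {Γ : Matrix (Fin d) (Fin d) ℝ} (hP : Γ.PosSemidef)
    (hΓ : ∀ i j, 0 ≤ Γ i j) {G : ℝ} (hG0 : 0 ≤ G) (hG : ∀ i, Γ i i ≤ G)
    {lam : ℝ} (hlam : 0 < lam) {m N T : ℕ} (hm : 1 ≤ m) (hd : 1 ≤ d) (hT : d ≤ T)
    (A : ℕ → Finset (Fin d)) (hA : ∀ t, 1 ≤ t → (A t).card = m)
    (hN : ∀ t, N < t → ∀ i, 1 ≤ pulls A t i) :
    ∑ t ∈ Finset.Ioc N T, √(confWidth Γ lam A t (A t))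
      ≤ 22 * √(d * T * G * widthBound Γ lam m A T) := by
  obtain ⟨hγ0, hγ1⟩ := maxCorr_mem hP hΓ A T
  unfold widthBound
  set γ := maxCorr Γ A T
  have hlg : 0 ≤ lam + 1 - γ := by linarith
  have hc := one_le_ceilLog m
  have hterm : ∀ t ∈ Finset.Ioc N T, √(confWidth Γ lam A t (A t))
      ≤ √(G * (lam + 1 - γ)) * √(∑ i ∈ A t, 1 / (pulls A t i : ℝ))
        + √(G * γ) * ∑ i ∈ A t, 1 / √(pulls A t i : ℝ) := by
    intro t ht
    rw [Finset.mem_Ioc] at ht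
    have h : confWidth Γ lam A t (A t)
        ≤ G * (lam + 1 - γ) * ∑ i ∈ A t, 1 / (pulls A t i : ℝ)
          + G * γ * (∑ i ∈ A t, 1 / √(pulls A t i : ℝ)) ^ 2 :=
      confWidth_le_corr hP hΓ hG hlam A (Finset.mem_Icc.2 ⟨by omega, ht.2⟩) (hN t ht.1)
    refine (Real.sqrt_le_sqrt h).trans ((sqrt_add_le_sqrt_add_sqrt (by positivity)
      (by positivity)).trans (le_of_eq ?_))
    rw [Real.sqrt_mul (x := G * (lam + 1 - γ)) (by positivity),
      Real.sqrt_mul (x := G * γ) (by positivity), Real.sqrt_sq (Finset.sum_nonneg fun i _ => by positivity)]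
  refine (Finset.sum_le_sum hterm).trans ?_
  rw [Finset.sum_add_distrib, ← Finset.mul_sum, ← Finset.mul_sum]
  have h1 := sum_sqrt_sum_inv_pulls_le A hd hT hA hN
  have h2 := sum_inv_sqrt_pulls_le A (T := T) hA hN
  set x : ℝ := d * T * G * (5 * (lam + 1 - γ) * (ceilLog m : ℝ) ^ 2) with hx
  set y : ℝ := d * T * G * (45 * γ * m) with hy
  have hx0 : 0 ≤ x := by positivity
  have hy0 : 0 ≤ y := by positivity
  have k1 : √(G * (lam + 1 - γ)) * ∑ t ∈ Finset.Ioc N T, √(∑ i ∈ A t, 1 / (pulls A t i : ℝ))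
      ≤ 8 * √x := by
    calc _ ≤ √(G * (lam + 1 - γ)) * (√(d * T) * (8 * ceilLog m)) := by
          gcongr
          refine h1.trans ?_
          gcongr
          exact sqrt_log_le_ceilLog hm
      _ = 8 * √(G * (lam + 1 - γ) * (d * T) * (ceilLog m : ℝ) ^ 2) := by
          rw [Real.sqrt_mul (x := G * (lam + 1 - γ) * (d * T)) (by positivity),
            Real.sqrt_mul (x := G * (lam + 1 - γ)) (by positivity), Real.sqrt_sq (by linarith)]
          ring
      _ ≤ _ := by
          gcongr
          rw [hx]
          have : 0 ≤ G * (lam + 1 - γ) * (d * T) * (ceilLog m : ℝ) ^ 2 := by positivity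
          linarith
  have k2 : √(G * γ) * ∑ t ∈ Finset.Ioc N T, ∑ i ∈ A t, 1 / √(pulls A t i : ℝ) ≤ 3 * √y := by
    calc _ ≤ √(G * γ) * (3 * √(d * T * m)) := by gcongr
      _ = 3 * √(G * γ * (d * T * m)) := by
          rw [Real.sqrt_mul (x := G * γ) (by positivity)]
          ring
      _ ≤ _ := by
          gcongr
          rw [hy]
          have : 0 ≤ G * γ * (d * T * m) := by positivity
          linarith
  have k3 := sqrt_add_sqrt_le hx0 hy0
  have e : (d : ℝ) * T * G * (5 * (lam + 1 - γ) * (ceilLog m : ℝ) ^ 2 + 45 * γ * m) = x + y := by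
    rw [hx, hy]; ring
  rw [e]
  have := Real.sqrt_nonneg x
  have := Real.sqrt_nonneg y
  linarith

lemma log_le_explorationFn (m : ℕ) {lam : ℝ} (hlam : 0 < lam) {t : ℕ} (ht : 3 ≤ t) :
    Real.log t ≤ explorationFn m lam t := by
  unfold explorationFn
  have h1 : 0 ≤ Real.log (Real.log t) := Real.log_nonneg (one_le_log ht)
  have h2 : 0 ≤ Real.log (1 + Real.exp 1 / lam) :=
    Real.log_nonneg (by have : 0 < Real.exp 1 / lam := by positivity
                        linarith)
  have : 0 ≤ ((m : ℝ) + 2) * Real.log (Real.log t) := by positivity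
  have : 0 ≤ (m : ℝ) / 2 * Real.log (1 + Real.exp 1 / lam) := by positivity
  linarith

/-- From some stage on, the exploration function is at most twice the logarithm of the horizon. -/
lemma exists_explorationFn_le (m : ℕ) (lam : ℝ) :
    ∃ t₀ : ℕ, ∀ T, t₀ ≤ T → ∀ t, 3 ≤ t → t ≤ T → explorationFn m lam t ≤ 2 * Real.log T := by
  have h : ∀ᶠ x : ℝ in Filter.atTop,
      ((m : ℝ) + 2) * Real.log x + (m : ℝ) / 2 * Real.log (1 + Real.exp 1 / lam) ≤ x := by
    have h1 := (Real.isLittleO_log_id_atTop.const_mul_left ((m : ℝ) + 2)).bound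
      (show (0 : ℝ) < 1 / 2 by norm_num)
    filter_upwards [h1, Filter.eventually_ge_atTop
      (2 * ((m : ℝ) / 2 * Real.log (1 + Real.exp 1 / lam))), Filter.eventually_ge_atTop 0]
      with x hx hx2 hx0
    have := (le_abs_self _).trans hx
    simp only [id, Real.norm_eq_abs, abs_of_nonneg hx0] at this
    linarith
  have h2 := (Real.tendsto_log_atTop.comp tendsto_natCast_atTop_atTop).eventually h
  obtain ⟨t₀, ht₀⟩ := Filter.eventually_atTop.1 h2
  refine ⟨t₀, fun T hT t ht htT => ?_⟩
  have h3 := ht₀ T hT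
  simp only [Function.comp_apply] at h3
  have ht' : (3 : ℝ) ≤ t := by exact_mod_cast ht
  have htT' : (t : ℝ) ≤ T := by exact_mod_cast htT
  have h4 : Real.log t ≤ Real.log T := Real.log_le_log (by linarith) htT'
  have h5 : Real.log (Real.log t) ≤ Real.log (Real.log T) :=
    Real.log_le_log (by linarith [one_le_log ht]) h4
  unfold explorationFn
  have : ((m : ℝ) + 2) * Real.log (Real.log t) ≤ ((m : ℝ) + 2) * Real.log (Real.log T) := by
    gcongr
  linarith

/-- The probability bound on the bad events is eventually at most `1 / √t`. -/
lemma exists_badEvent_bound_le (d : ℕ) {ε : ℝ} (hε : 0 < ε) :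
    ∃ t₀ : ℕ, ∀ t : ℕ, t₀ ≤ t →
      (2 * (gridSize ε t : ℝ) + 2) ^ d * (2 * Real.exp (-level t)) ≤ 1 / √(t : ℝ) := by
  -- With `x = log t`, the polylogarithmic size of the net costs at most `t^(1/4)`, which leaves
  -- `t^(-1/2)` out of `t^(-3/4)`.
  have h : ∀ᶠ x : ℝ in Filter.atTop, (6 / ε + 6) ^ d * x ^ d * 2 ≤ Real.exp (1 / 4 * x) := by
    have h1 := ((isLittleO_pow_exp_pos_mul_atTop d (show (0 : ℝ) < 1 / 4 by norm_num)).const_mul_left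
      ((6 / ε + 6) ^ d * 2)).bound (show (0 : ℝ) < 1 by norm_num)
    filter_upwards [h1] with x hx
    have := (le_abs_self _).trans hx
    rw [Real.norm_eq_abs, abs_of_pos (Real.exp_pos _)] at this
    linarith
  have h2 := (Real.tendsto_log_atTop.comp tendsto_natCast_atTop_atTop).eventually h
  obtain ⟨t₀, ht₀⟩ := Filter.eventually_atTop.1 h2
  refine ⟨max 3 t₀, fun t ht => ?_⟩
  have h3 := ht₀ t ((le_max_right _ _).trans ht)
  have ht3 := (le_max_left _ _).trans ht
  have hl := one_le_log ht3
  have ht' : (0 : ℝ) < t := by have : 0 < t := by omega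
                               exact_mod_cast this
  simp only [Function.comp_apply] at h3
  have hg : 2 * (gridSize ε t : ℝ) + 2 ≤ (6 / ε + 6) * Real.log t := by
    have h4 := Nat.ceil_lt_add_one (show 0 ≤ 3 * Real.log t / ε by positivity)
    unfold gridSize
    push_cast
    have e : (6 / ε + 6) * Real.log t = 2 * (3 * Real.log t / ε) + 6 * Real.log t := by ring
    rw [e]
    linarith
  have e1 : 1 / √(t : ℝ) = Real.exp (-(1 / 2 * Real.log t)) := by
    rw [Real.exp_neg, one_div]
    congr 1
    rw [Real.sqrt_eq_rpow, Real.rpow_def_of_pos ht']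
    congr 1; ring
  rw [e1]
  calc _ ≤ ((6 / ε + 6) * Real.log t) ^ d * (2 * Real.exp (-level t)) := by gcongr
    _ = ((6 / ε + 6) ^ d * Real.log t ^ d * 2) * Real.exp (-level t) := by rw [mul_pow]; ring
    _ ≤ Real.exp (1 / 4 * Real.log t) * Real.exp (-level t) := by gcongr
    _ = _ := by
      rw [← Real.exp_add]
      congr 1
      unfold level
      ring

lemma exists_isLarge (Γ : Matrix (Fin d) (Fin d) ℝ) (hΓ : ∀ i j, 0 ≤ Γ i j) {lam : ℝ}
    (hlam : 0 < lam) : ∃ R, ∃ t₀ : ℕ, ∀ t, t₀ ≤ t → IsLarge Γ lam R t := by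
  let R : ℝ := 1 + ∑ i, ∑ j, Γ i j + ∑ i, 1 / Γ i i
  have hs1 : 0 ≤ ∑ i, ∑ j, Γ i j := Finset.sum_nonneg fun i _ => Finset.sum_nonneg fun j _ => hΓ i j
  have hs2 : 0 ≤ ∑ i, 1 / Γ i i := Finset.sum_nonneg fun i _ => one_div_nonneg.2 (hΓ i i)
  have hR1 : 1 ≤ R := by dsimp only [R]; linarith
  obtain ⟨n, hn⟩ := exists_nat_ge (3 + 2 * R + 2 * R / lam + (lam + 1) * (d : ℝ) ^ 2 * R)
  have p1 : 0 ≤ 2 * R / lam := by positivity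
  have p2 : 0 ≤ (lam + 1) * (d : ℝ) ^ 2 * R := by positivity
  refine ⟨R, n, fun t ht => ?_⟩
  have ht' : (n : ℝ) ≤ t := by exact_mod_cast ht
  refine ⟨?_, hR1, fun i j => ?_, fun i hi => ?_, by linarith, ?_, by linarith⟩
  · have : (3 : ℝ) ≤ t := by linarith
    exact_mod_cast this
  · have h1 : Γ i j ≤ ∑ j, Γ i j :=
      Finset.single_le_sum (f := fun j => Γ i j) (fun j _ => hΓ i j) (Finset.mem_univ j)
    have h2 : ∑ j, Γ i j ≤ ∑ i, ∑ j, Γ i j :=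
      Finset.single_le_sum (f := fun i => ∑ j, Γ i j)
        (fun i _ => Finset.sum_nonneg fun j _ => hΓ i j) (Finset.mem_univ i)
    dsimp only [R]
    linarith
  · have h1 : 1 / Γ i i ≤ ∑ i, 1 / Γ i i :=
      Finset.single_le_sum (f := fun i => 1 / Γ i i) (fun i _ => one_div_nonneg.2 (hΓ i i))
        (Finset.mem_univ i)
    have h2 : 1 / Γ i i ≤ R := by dsimp only [R]; linarith
    rw [one_div_le (by linarith) hi]
    exact h2
  · have : 2 * R / lam ≤ t := by linarith
    rw [div_le_iff₀ hlam] at this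
    linarith

/-- Optimism: when the deviations are controlled, the gap of the chosen action is at most twice its
exploration term. -/
lemma gap_le_of_dev {Γ : Matrix (Fin d) (Fin d) ℝ} {lam : ℝ} (hlam : 0 < lam) {m t : ℕ}
    (ht : 3 ≤ t) {A : ℕ → Finset (Fin d)} {x : ℕ → Fin d → ℝ} {μ : Fin d → ℝ}
    {a : Finset (Fin d)} (hn : ∀ i, 1 ≤ pulls A t i)
    (hdev : ∀ S, S.card = m → |∑ i ∈ S, 1 / (pulls A t i : ℝ) * noise A x μ t i|
      ≤ √(2 * Real.log t) * √(confWidth Γ lam A t S))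
    (ha : a.card = m) (hAt : (A t).card = m)
    (hargmax : ucbIndex m Γ lam A x t a ≤ ucbIndex m Γ lam A x t (A t)) :
    gap μ a (A t) ≤ 2 * √(2 * explorationFn m lam t) * √(confWidth Γ lam A t (A t)) := by
  unfold ucbIndex at hargmax
  rw [explorationTerm_eq m Γ lam A t _ hn, explorationTerm_eq m Γ lam A t _ hn,
    reward_empMean A x μ t _ hn, reward_empMean A x μ t _ hn] at hargmax
  have hf : √(2 * Real.log t) ≤ √(2 * explorationFn m lam t) :=
    Real.sqrt_le_sqrt (by linarith [log_le_explorationFn m hlam ht])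
  have key : ∀ S, S.card = m → |∑ i ∈ S, 1 / (pulls A t i : ℝ) * noise A x μ t i|
      ≤ √(2 * explorationFn m lam t) * √(confWidth Γ lam A t S) := fun S hS =>
    (hdev S hS).trans (by gcongr)
  have h1 := (abs_le.1 (key a ha)).1
  have h2 := (abs_le.1 (key (A t) hAt)).2
  unfold gap
  linarith

lemma sum_inv_sqrt_le (T : ℕ) : ∑ t ∈ Finset.Icc 1 T, 1 / √(t : ℝ) ≤ 3 * √((T + 1 : ℕ) : ℝ) := by
  induction T with
  | zero => simp
  | succ T ih =>
    rw [Finset.sum_Icc_succ_top (by omega)]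
    have := inv_sqrt_le_sqrt_succ_sub (n := T + 1) (by omega)
    linarith

end SemiBandit

end

/-! ### Assembly of the regret bound. -/

open SemiBandit in
theorem mainTheorem3 :
    ∃ c : ℝ, 0 < c ∧
      ∀ (d m : ℕ), 1 ≤ m → m ≤ d →
      ∀ (Γ : Matrix (Fin d) (Fin d) ℝ), Γ.PosSemidef → (∀ i j, 0 ≤ Γ i j) → (∃ i, 0 < Γ i i) →
      ∀ (lam : ℝ), 0 < lam →
      ∀ (B : ℝ) (N : ℕ),
      ∃ T₀ : ℕ,
        ∀ (C : Matrix (Fin d) (Fin d) ℝ), C.PosSemidef → SemiBandit.PosLE C Γ →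
        ∀ (μ : Fin d → ℝ) (𝒜 : Finset (Finset (Fin d))), (∀ S ∈ 𝒜, S.card = m) →
        ∀ (a : Finset (Fin d)), SemiBandit.IsBest 𝒜 μ a →
        (∀ S ∈ 𝒜, SemiBandit.gap μ a S ≤ B) →
        ∀ (Ω : Type*) [mΩ : MeasurableSpace Ω] (P : Measure Ω) [IsProbabilityMeasure P]
          (ℱ : Filtration ℕ mΩ) (X : ℕ → Ω → Fin d → ℝ) (A : ℕ → Ω → Finset (Fin d)),
        SemiBandit.IsEnvironment P ℱ C μ X →
        SemiBandit.IsOLSUCB ℱ m Γ lam N 𝒜 X A →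
        ∀ T : ℕ, T₀ ≤ T →
          SemiBandit.expectedRegret P μ a A T ≤
            c * ∫ ω, Real.sqrt (d * T * Real.log T * (⨆ i, Γ i i) *
              (5 * (lam + 1 - SemiBandit.maxCorr Γ (fun t => A t ω) T)
                  * (SemiBandit.ceilLog m : ℝ) ^ 2
                + 45 * SemiBandit.maxCorr Γ (fun t => A t ω) T * m)) ∂P := by
  -- `88 = 4 · 22` from the good stages, plus `1` for the early and bad stages.
  refine ⟨89, by norm_num, ?_⟩
  intro d m hm hmd Γ hP hΓ hpos lam hlam B N
  have hd : 1 ≤ d := hm.trans hmd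
  set G : ℝ := ⨆ i, Γ i i with hGdef
  have hG : ∀ i, Γ i i ≤ G := fun i => le_ciSup (Set.finite_range fun i => Γ i i).bddAbove i
  have hG0 : 0 < G := by
    obtain ⟨i, hi⟩ := hpos
    exact hi.trans_le (hG i)
  obtain ⟨R, n₁, hn₁⟩ := exists_isLarge Γ hΓ hlam
  obtain ⟨n₂, hn₂⟩ := exists_badEvent_bound_le d (mesh_pos hm hlam)
  obtain ⟨n₃, hn₃⟩ := exists_explorationFn_le m lam
  set t₁ : ℕ := max (max n₁ n₂) (max N 3) with ht₁
  have ht₁1 : n₁ ≤ t₁ := (le_max_left _ _).trans (le_max_left _ _)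
  have ht₁2 : n₂ ≤ t₁ := (le_max_right _ _).trans (le_max_left _ _)
  have ht₁3 : N ≤ t₁ := (le_max_left _ _).trans (le_max_right _ _)
  have ht₁4 : 3 ≤ t₁ := (le_max_right _ _).trans (le_max_right _ _)
  -- Chosen so that `B (t₁ + 6) √T` is at most `√(T log T · G · 5 lam)`. Only `B`, `lam`, `G` and
  -- `t₁` enter, so the threshold is uniform over the problems.
  have hlog : ∀ᶠ T : ℕ in Filter.atTop,
      (B * (t₁ + 6)) ^ 2 / (5 * lam * G) ≤ Real.log T :=
    (Real.tendsto_log_atTop.comp tendsto_natCast_atTop_atTop).eventually_ge_atTop _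
  obtain ⟨n₄, hn₄⟩ := Filter.eventually_atTop.1 hlog
  refine ⟨max (max t₁ n₃) (max n₄ d), ?_⟩
  intro C _ hC μ 𝒜 h𝒜 a ha hB Ω mΩ P _ ℱ X A hE hO T hT
  have hTt₁ : t₁ ≤ T := ((le_max_left _ _).trans (le_max_left _ _)).trans hT
  have hTn₃ : n₃ ≤ T := ((le_max_right _ _).trans (le_max_left _ _)).trans hT
  have hTn₄ : n₄ ≤ T := ((le_max_left _ _).trans (le_max_right _ _)).trans hT
  have hTd : d ≤ T := ((le_max_right _ _).trans (le_max_right _ _)).trans hT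
  have hB0 : 0 ≤ B := by
    have := hB a ha.1
    simpa [gap] using this
  have hT1 : (1 : ℝ) ≤ T := by
    have : 1 ≤ T := by omega
    exact_mod_cast this
  have hlT : 1 ≤ Real.log T := one_le_log (by omega)
  have hd1 : (1 : ℝ) ≤ d := by exact_mod_cast hd
  have hcard : ∀ ω t, 1 ≤ t → (A t ω).card = m := fun ω t ht => h𝒜 _ (hO.mem t ht ω)
  have hpulls : ∀ ω t, t₁ < t → ∀ i, 1 ≤ pulls (fun s => A s ω) t i := by
    intro ω t ht i
    obtain ⟨s, hs, his⟩ := hO.init ω i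
    rw [Finset.mem_Icc] at hs
    exact Finset.card_pos.2 ⟨s, Finset.mem_filter.2 ⟨Finset.mem_Ico.2 (by omega), his⟩⟩
  set bad : ℕ → Set Ω := fun t => badEvent Γ μ A X (mesh m lam) t with hbad
  have hbadm : ∀ t, 1 ≤ t → MeasurableSet (bad t) := fun t ht =>
    measurableSet_badEvent hE hO.predictable _ ht
  have hbadP : ∀ t, t₁ < t → P.real (bad t) ≤ 1 / √(t : ℝ) := fun t ht =>
    (measure_badEvent_le hE hC hO.predictable _ (by omega)).trans (hn₂ t (by omega))
  have hnoise : ∀ᵐ ω ∂P, ∀ i, Γ i i = 0 → ∀ t, 1 ≤ t → X t ω i = μ i := by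
    rw [ae_all_iff]; intro i
    rw [Filter.eventually_imp_distrib_left]; intro hi
    rw [ae_all_iff]; intro t
    rw [Filter.eventually_imp_distrib_left]; intro ht
    exact ae_eq_mean_of_diag_eq_zero hE hC hi ht
  have hgapB : ∀ ω t, 1 ≤ t → gap μ a (A t ω) ≤ B := fun ω t ht => hB _ (hO.mem t ht ω)
  let F : (ℕ → Finset (Fin d)) → ℝ := fun A' =>
    √(d * T * Real.log T * G * widthBound Γ lam m A' T)
  have hFint : Integrable (fun ω => F fun t => A t ω) P := by
    refine integrable_of_actions hO.predictable T F fun A₁ A₂ h => ?_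
    have : maxCorr Γ A₁ T = maxCorr Γ A₂ T := by
      unfold maxCorr
      congr 1
      ext r
      simp only [Set.mem_ofPred_eq]
      exact exists_congr fun t => and_congr_right fun ht => by rw [h t ht]
    simp only [F, widthBound, this]
  have hRint : Integrable (fun ω => ∑ t ∈ Finset.Icc 1 T, gap μ a (A t ω)) P := by
    refine integrable_of_actions hO.predictable T
      (fun A' => ∑ t ∈ Finset.Icc 1 T, gap μ a (A' t)) fun A₁ A₂ h => ?_
    exact Finset.sum_congr rfl fun t ht => by rw [h t ht]
  have hgapgood : ∀ᵐ ω ∂P, ∀ t, t₁ < t → t ≤ T → ω ∉ bad t → gap μ a (A t ω)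
      ≤ 4 * √(Real.log T) * √(confWidth Γ lam (fun s => A s ω) t (A t ω)) := by
    filter_upwards [hnoise] with ω hω t ht htT hgood
    have hgood' : ∀ u ∈ net d (mesh m lam) (gridSize (mesh m lam) t),
        |∑ i, u i * noise (fun s => A s ω) (fun s => X s ω) μ t i|
          ≤ 1 / 2 * quadForm Γ (fun s => A s ω) t u + level t := by
      intro u hu
      simp only [hbad, badEvent, Set.mem_iUnion, Set.mem_union, Set.mem_ofPred_eq, not_exists,
        not_or, not_le] at hgood
      obtain ⟨h1, h2⟩ := hgood u hu
      rw [expStat_eq] at h1 h2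
      rw [quadForm_neg] at h2
      simp only [Pi.neg_apply, neg_mul, Finset.sum_neg_distrib] at h2
      rw [abs_le]
      constructor <;> linarith
    have hzero : ∀ i, Γ i i = 0 → noise (fun s => A s ω) (fun s => X s ω) μ t i = 0 := by
      intro i hi
      refine Finset.sum_eq_zero fun s hs => ?_
      simp only [Finset.mem_filter, Finset.mem_Ico] at hs
      exact sub_eq_zero.2 (hω i hi s hs.1.1)
    have hdev := abs_dev_le hd hΓ hlam hm (hn₁ t (by omega)) (fun s => A s ω) _
      (hpulls ω t ht) hgood' hzero
    refine (gap_le_of_dev hlam (by omega) (hpulls ω t ht) hdev (h𝒜 a ha.1) (hcard ω t (by omega))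
      (hO.argmax t (by omega) ω a ha.1)).trans ?_
    have hf := hn₃ T hTn₃ t (by omega) htT
    have : √(2 * explorationFn m lam t) ≤ 2 * √(Real.log T) := by
      rw [Real.sqrt_le_left (by positivity), mul_pow, Real.sq_sqrt (by linarith)]
      linarith
    calc _ ≤ 2 * (2 * √(Real.log T)) * √(confWidth Γ lam (fun s => A s ω) t (A t ω)) := by gcongr
      _ = _ := by ring
  -- The trivial bound `B` is paid at the first `t₁` stages and at bad stages; all others are
  -- charged to their widths.
  have hpath : ∀ᵐ ω ∂P, ∑ t ∈ Finset.Icc 1 T, gap μ a (A t ω)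
      ≤ B * t₁ + ∑ t ∈ Finset.Ioc t₁ T, B * (bad t).indicator (fun _ => (1 : ℝ)) ω
        + 88 * F fun t => A t ω := by
    filter_upwards [hgapgood] with ω hω
    have e : Finset.Icc 1 T = Finset.Ioc 0 T := rfl
    rw [e, ← Finset.sum_Ioc_consecutive _ (Nat.zero_le t₁) hTt₁, add_assoc]
    refine add_le_add ?_ ?_
    · calc _ ≤ ∑ t ∈ Finset.Ioc 0 t₁, B := Finset.sum_le_sum fun t ht => by
            rw [Finset.mem_Ioc] at ht; exact hgapB ω t ht.1
        _ = _ := by simp [mul_comm]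
    · have hsum := sum_sqrt_confWidth_le hP hΓ hG0.le hG hlam hm hd hTd (fun t => A t ω)
        (hcard ω) (hpulls ω)
      have hterm : ∀ t ∈ Finset.Ioc t₁ T, gap μ a (A t ω)
          ≤ B * (bad t).indicator (fun _ => (1 : ℝ)) ω
            + 4 * √(Real.log T) * √(confWidth Γ lam (fun s => A s ω) t (A t ω)) := by
        intro t ht
        rw [Finset.mem_Ioc] at ht
        by_cases hb : ω ∈ bad t
        · rw [Set.indicator_of_mem hb, mul_one]
          have h1 := hgapB ω t (by omega)
          have h2 : 0 ≤ 4 * √(Real.log T) * √(confWidth Γ lam (fun s => A s ω) t (A t ω)) := by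
            positivity
          linarith
        · rw [Set.indicator_of_notMem hb, mul_zero, zero_add]
          exact hω t ht.1 ht.2 hb
      refine (Finset.sum_le_sum hterm).trans ?_
      rw [Finset.sum_add_distrib, ← Finset.mul_sum (f := fun t =>
        √(confWidth Γ lam (fun s => A s ω) t (A t ω)))]
      refine add_le_add le_rfl ?_
      calc _ ≤ 4 * √(Real.log T)
            * (22 * √(d * T * G * widthBound Γ lam m (fun t => A t ω) T)) := by gcongr
        _ = 88 * (√(Real.log T) * √(d * T * G * widthBound Γ lam m (fun t => A t ω) T)) := by ring
        _ = _ := by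
          rw [← Real.sqrt_mul (by linarith)]
          simp only [F]
          congr 2
          ring
  have hind : ∀ t ∈ Finset.Ioc t₁ T,
      Integrable (fun ω => B * (bad t).indicator (fun _ => (1 : ℝ)) ω) P := fun t ht =>
    ((integrable_const _).indicator
      (hbadm t (by rw [Finset.mem_Ioc] at ht; omega))).const_mul _
  have hbound : expectedRegret P μ a A T
      ≤ B * t₁ + ∑ t ∈ Finset.Ioc t₁ T, B * P.real (bad t) + 88 * ∫ ω, (F fun t => A t ω) ∂P := by
    have hI1 : Integrable (fun ω => ∑ t ∈ Finset.Ioc t₁ T,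
      B * (bad t).indicator (fun _ => (1 : ℝ)) ω) P := integrable_finsetSum _ hind
    have hI2 : Integrable (fun ω => B * t₁ + ∑ t ∈ Finset.Ioc t₁ T,
      B * (bad t).indicator (fun _ => (1 : ℝ)) ω) P := (integrable_const _).add hI1
    refine (integral_mono_ae hRint (hI2.add (hFint.const_mul 88)) hpath).trans (le_of_eq ?_)
    simp only [Pi.add_apply]
    rw [integral_add hI2 (hFint.const_mul 88), integral_add (integrable_const _) hI1,
      integral_finsetSum _ hind, integral_const_mul (88 : ℝ)]
    simp only [integral_const, probReal_univ, smul_eq_mul, one_mul]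
    congr 2
    refine Finset.sum_congr rfl fun t ht => ?_
    rw [integral_const_mul, integral_indicator_const _
      (hbadm t (by rw [Finset.mem_Ioc] at ht; omega))]
    simp
  have hsumP : ∑ t ∈ Finset.Ioc t₁ T, B * P.real (bad t) ≤ B * (6 * √(T : ℝ)) := by
    rw [← Finset.mul_sum]
    gcongr
    calc _ ≤ ∑ t ∈ Finset.Ioc t₁ T, 1 / √(t : ℝ) := Finset.sum_le_sum fun t ht =>
          hbadP t (Finset.mem_Ioc.1 ht).1
      _ ≤ ∑ t ∈ Finset.Icc 1 T, 1 / √(t : ℝ) := by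
          refine Finset.sum_le_sum_of_subset_of_nonneg ?_ fun _ _ _ => by positivity
          intro t ht
          simp only [Finset.mem_Ioc, Finset.mem_Icc] at *
          omega
      _ ≤ _ := sum_inv_sqrt_le T
      _ ≤ 3 * (2 * √(T : ℝ)) := by
          gcongr
          rw [Real.sqrt_le_left (by positivity), mul_pow, Real.sq_sqrt (by linarith)]
          push_cast
          linarith
      _ = _ := by ring
  have hFlow : B * t₁ + B * (6 * √(T : ℝ)) ≤ ∫ ω, (F fun t => A t ω) ∂P := by
    have hsT : 1 ≤ √(T : ℝ) := Real.one_le_sqrt.2 hT1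
    have h1 : B * t₁ + B * (6 * √(T : ℝ)) ≤ √(d * T * Real.log T * G * (5 * lam)) := by
      calc B * t₁ + B * (6 * √(T : ℝ)) ≤ B * (t₁ + 6) * √(T : ℝ) := by
            have : B * t₁ * 1 ≤ B * t₁ * √(T : ℝ) := by gcongr
            nlinarith
        _ ≤ _ := by
            apply Real.le_sqrt_of_sq_le
            rw [mul_pow, Real.sq_sqrt (by linarith)]
            have h2 := hn₄ T hTn₄
            rw [div_le_iff₀ (by positivity)] at h2
            calc _ ≤ Real.log T * (5 * lam * G) * T := by gcongr
              _ = 1 * (Real.log T * (5 * lam * G) * T) := by ring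
              _ ≤ d * (Real.log T * (5 * lam * G) * T) := by gcongr
              _ = _ := by ring
    -- Since `γ ≤ 1` and the rounded logarithm is at least `1`, the random bound never falls below
    -- this deterministic quantity, which absorbs the lower-order terms.
    have h2 : ∀ ω, √(d * T * Real.log T * G * (5 * lam)) ≤ F fun t => A t ω := by
      intro ω
      obtain ⟨hγ0, hγ1⟩ := maxCorr_mem hP hΓ (fun t => A t ω) T
      have hc := one_le_ceilLog m
      apply Real.sqrt_le_sqrt
      gcongr
      unfold widthBound
      have h3 : 5 * lam * 1 ≤ 5 * (lam + 1 - maxCorr Γ (fun t => A t ω) T)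
          * (ceilLog m : ℝ) ^ 2 := by
        gcongr
        · linarith
        · linarith
        · nlinarith
      have h4 : 0 ≤ 45 * maxCorr Γ (fun t => A t ω) T * m := by positivity
      linarith
    have h3 := integral_mono (integrable_const (√(d * T * Real.log T * G * (5 * lam)))) hFint h2
    rw [integral_const, probReal_univ, one_smul] at h3
    exact h1.trans h3
  change _ ≤ 89 * ∫ ω, (F fun t => A t ω) ∂P
  linarith
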